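/- Let $F\in\mathbb C[x,y,z]$ be a homogeneous quartic form such that the plane curve $X=\{F=0\}\subset\mathbb P^2$ is nonsingular, and suppose that $\infty=(0:1:0)$ is the only point of $X$ on the line $z=0$ (so that $X\cdot\{z=0\}=4\infty$, i.e. $\infty$ is a hyperflex of $X$). For an effective divisor $E$ on $X$, call $E$ collinear if there is a line $L$ with $L\cdot X\ge E$ (equivalently $h^1(X,\mathcal O(E))\neq 0$). Let $\mathrm{Div}^{3,+}_0(X)$ be the set of effective divisors $D=p_1+p_2+p_3$ of degree $3$ on $X$ (points may be repeated) such that $p_i\ne\infty$ for all $i$, $D$ is not collinear, and $p_i+p_j+\infty$ is not collinear for all indices $i\neq j$. Let $Z$ be the set of quadruples $(A,B,G,H)$ of quadratic forms in $x,y,z$ with $F=AG+BH$ such that, in the affine coordinates $z=1$, $$A=a_{00}+a_{10}x+a_{01}y-x^2,\qquad B=b_{00}+b_{10}x+b_{01}y-xy$$ for some complex numbers $a_{ij},b_{ij}$, and such that the coefficient $g_{11}$ of $xy$ in $G$ equals $1$. Then there is a bijection $\mathrm{Div}^{3,+}_0(X)\to Z$, $D\mapsto(A,B,G,H)$, such that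 for every $D$ the conics $A,B$ span the pencil of conics through $D+\infty$, i.e. the linear span of $A$ and $B$ is the space of all quadratic forms $C$ with $C\cdot X\ge D+\infty$ (together with $C=0$). -/

import Mathlib

open MvPolynomial

/-- Polynomials in the homogeneous coordinates `x = X 0`, `y = X 1`, `z = X 2`. -/
abbrev Poly3 : Type := MvPolynomial (Fin 3) ℂ

/-- The complex projective plane. -/
abbrev Plane : Type := Projectivization ℂ (Fin 3 → ℂ)

/-- The points of the plane curve `{F = 0}` (used for homogeneous `F` only, so that the choice of the
representative `p.rep` of a point `p` plays no role). -/
def curve (F : Poly3) : Set Plane := {p | eval p.rep F = 0}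

/-- The curve `{F = 0}` is nonsingular: at no point do `F` and all its partial derivatives vanish. -/
def IsNonsingularCurve (F : Poly3) : Prop :=
  ∀ v : Fin 3 → ℂ, v ≠ 0 → eval v F = 0 → ∃ i, eval v (pderiv i F) ≠ 0

/-- The point `∞ = (0 : 1 : 0)`. -/
noncomputable def inftyPt : Plane :=
  Projectivization.mk ℂ ![0, 1, 0] (fun h => one_ne_zero (α := ℂ) (congrFun h 1))

/-- The ideal of polynomials vanishing at the representative of `p`. -/
noncomputable def pointIdeal (p : Plane) : Ideal Poly3 := RingHom.ker (eval p.rep)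

/-- For a form `C` and a point `p` of the nonsingular curve `X = {F = 0}`, membership of `C` in this
ideal says that `C.X ≥ n p`, i.e. that `C`, restricted to `X`, has order at least `n` at `p`.

Indeed, let `w = 1` (`w` a linear form with `w (p.rep) = 1`) be the affine chart around `p`, let `f`, `c`
be the dehomogenizations of `F`, `C`, and `m` the maximal ideal of `p` in the chart.
The local ring of `X` at `p` is a discrete valuation ring, and `C` has order at least `n` if and only if
`c` lies in the `n`-th power of its maximal ideal. This means `c ∈ (f) + m ^ n`, no localization
being needed because everything that does not vanish at `p` is already invertible modulo `m ^ n`.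
As `F` and `C` are homogeneous and `w` is invertible modulo `(pointIdeal p) ^ n`, this is in turn the
same as `C ∈ (F) + (pointIdeal p) ^ n` in the homogeneous coordinates. -/
noncomputable def orderIdeal (F : Poly3) (p : Plane) (n : ℕ) : Ideal Poly3 :=
  Ideal.span {F} ⊔ pointIdeal p ^ n

/-- The space of forms `C` of degree `d` with `C.X ≥ D`, for an effective divisor `D` on the nonsingular
curve `X = {F = 0}`; the coefficient of `D` at `p` is `D p`. -/
noncomputable def formsThrough (F : Poly3) (d : ℕ) (D : Plane →₀ ℕ) : Submodule ℂ Poly3 :=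
  homogeneousSubmodule (Fin 3) ℂ d ⊓ ⨅ p : Plane, (orderIdeal F p (D p)).restrictScalars ℂ

/-- No line `L` satisfies `L.X ≥ D`: the points of `D`, counted with multiplicity, are not collinear.
On a nonsingular plane quartic `X` the canonical divisors are the divisors `L.X`, so that this is
`h⁰(X, O(K - D)) = 0`, that is, `h¹(X, O(D)) = 0`. -/
def NotCollinear (F : Poly3) (D : Plane →₀ ℕ) : Prop := formsThrough F 1 D = ⊥

/-- The set `Div^{3,+}_0(X)` of effective divisors `D = p₁ + p₂ + p₃` of degree 3 on `X = {F = 0}`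
that avoid `∞`, that are not collinear, and for which no `pᵢ + pⱼ + ∞` (`i ≠ j`; the points
`pᵢ`, `pⱼ` may coincide if the multiplicity is at least 2) is collinear. -/
def Div30 (F : Poly3) : Set (Plane →₀ ℕ) :=
  {D | (∀ p ∈ D.support, p ∈ curve F) ∧ D.degree = 3 ∧ D inftyPt = 0 ∧ NotCollinear F D ∧
    ∀ p q : Plane, Finsupp.single p 1 + Finsupp.single q 1 ≤ D →
      NotCollinear F (Finsupp.single p 1 + Finsupp.single q 1 + Finsupp.single inftyPt 1)}

/-- A quadruple `(A, B, G, H)` of ternary forms. -/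
@[ext]
structure Quadruple where
  A : Poly3
  B : Poly3
  G : Poly3
  H : Poly3

/-- The set `Z` of quadruples of quadratic forms with `F = A G + B H`, where in affine coordinates
(`z = 1`) `A = a₀₀ + a₁₀ x + a₀₁ y - x²`, `B = b₀₀ + b₁₀ x + b₀₁ y - x y`, and where the
coefficient of `x y` in `G` is 1. -/
def ZSet (F : Poly3) : Set Quadruple :=
  {Q | Q.A.IsHomogeneous 2 ∧ Q.B.IsHomogeneous 2 ∧ Q.G.IsHomogeneous 2 ∧ Q.H.IsHomogeneous 2 ∧
    F = Q.A * Q.G + Q.B * Q.H ∧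
    (∃ a00 a10 a01 : ℂ,
      Q.A = C a00 * X 2 ^ 2 + C a10 * (X 0 * X 2) + C a01 * (X 1 * X 2) - X 0 ^ 2) ∧
    (∃ b00 b10 b01 : ℂ,
      Q.B = C b00 * X 2 ^ 2 + C b10 * (X 0 * X 2) + C b01 * (X 1 * X 2) - X 0 * X 1) ∧
    coeff (Finsupp.single 0 1 + Finsupp.single 1 1) Q.G = 1}

/-! ### Forms in three variables -/

/-! In the chart z = 1 the lines through ∞, apart from z = 0, are the vertical ones. All points of D
are affine, as X meets z = 0 only at ∞. That no p_i + p_j + ∞ is collinear means that distinct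
points of D have distinct abscissae and that X has no vertical tangent at a multiple point. Hence D
lies on a graph y = q(x) with deg q ≤ 2, by Hermite interpolation (`exists_graph_of_Div30`), and
noncollinearity forces deg q = 2. A cubic c dividing F(x, q(x), 1) cuts out D on this graph. After
scaling, the graph is a conic A with a₀₁ ≠ 0, and c is, up to a scalar, the restriction of a conic
B.

So both sides are parametrised by the pairs (A, B) with a₀₁ ≠ 0 for which B|A divides F|A, where |A
is restriction to the graph. For divisors this is `exists_conicDivisor_eq` and
`conicDivisor_mem_Div30`; the pair is recovered from D because the pencil through D + ∞ is spanned
by A and B (`span_conics_eq_formsThrough`) and contains only one conic of each normalised shape.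

For quadruples, the hyperflex removes y⁴ and xy³ from F, so F|A has degree at most 6 and its
quotient by B|A degree at most 3. Such a quotient is H|A for a quadratic form H; then F - BH
vanishes on A, hence equals AG (`exists_cofactors`). The only freedom is (G + tB, H - tA), and g₁₁ =
1 fixes t (`cofactors_unique`). Conversely F = AG + BH restricts to F|A = B|A · H|A, and a₀₁ ≠ 0
because X is nonsingular at ∞ (`conicA_coeff_ne_zero`).

Orders along X become computable through `mem_orderIdeal_iff_dvd`: where a graph has contact n with
X, order at least n means divisibility by (x - α)ⁿ on the graph. -/

lemma aeval_mul_of_isHomogeneous {S : Type*} [CommRing S] [Algebra ℂ S] {P : Poly3} {d : ℕ}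
    (hP : P.IsHomogeneous d) (r : S) (g : Fin 3 → S) :
    aeval (fun i => r * g i) P = r ^ d * aeval g P := by
  rw [aeval_def, aeval_def, eval₂_eq', eval₂_eq', Finset.mul_sum]
  refine Finset.sum_congr rfl fun e he => ?_
  have : ∑ i, e i = d := by
    rw [← Finsupp.degree_eq_sum]
    by_contra h
    exact (mem_support_iff.1 he) (hP.coeff_eq_zero h)
  simp_rw [mul_pow, Finset.prod_mul_distrib, Finset.prod_pow_eq_pow_sum, this]
  ring

lemma eval_smul_of_isHomogeneous {P : Poly3} {d : ℕ} (hP : P.IsHomogeneous d) (r : ℂ)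
    (g : Fin 3 → ℂ) : eval (r • g) P = r ^ d * eval g P := by
  have := aeval_mul_of_isHomogeneous hP r g
  rwa [aeval_eq_eval, aeval_eq_eval] at this

lemma exists_eq_sum_of_isHomogeneous {P : Poly3} {n : ℕ} (hP : P.IsHomogeneous n) :
    ∃ c : ℕ → ℕ → ℂ, P = ∑ i ∈ Finset.range (n + 1), ∑ j ∈ Finset.range (n + 1 - i),
      C (c i j) * (X 0 ^ i * X 1 ^ j * X 2 ^ (n - i - j)) := by
  rw [P.as_sum]
  refine Finset.sum_induction _ (fun P => ∃ c : ℕ → ℕ → ℂ, P = ∑ i ∈ Finset.range (n + 1),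
    ∑ j ∈ Finset.range (n + 1 - i), C (c i j) * (X 0 ^ i * X 1 ^ j * X 2 ^ (n - i - j))) ?_ ?_ ?_
  · rintro _ _ ⟨c, rfl⟩ ⟨d, rfl⟩
    refine ⟨c + d, ?_⟩
    simp_rw [← Finset.sum_add_distrib, Pi.add_apply, C_add, add_mul]
  · exact ⟨0, by simp⟩
  · intro e he
    have hs : e 0 + e 1 + e 2 = n := by
      rw [← Fin.sum_univ_three, ← Finsupp.degree_eq_sum]
      by_contra h
      exact (mem_support_iff.1 he) (hP.coeff_eq_zero h)
    refine ⟨fun i j => if i = e 0 ∧ j = e 1 then coeff e P else 0, ?_⟩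
    rw [Finset.sum_eq_single (e 0), Finset.sum_eq_single (e 1)]
    · rw [monomial_eq, Finsupp.prod_fintype _ _ (by simp), Fin.prod_univ_three]
      have : n - e 0 - e 1 = e 2 := by omega
      simp [this]
    · intro j _ hj
      simp [hj]
    · intro h
      exact absurd (Finset.mem_range.2 (by omega)) h
    · intro i _ hi
      simp [hi]
    · intro h
      exact absurd (Finset.mem_range.2 (by omega)) h

lemma aeval_vec_three {S : Type*} [CommRing S] [Algebra ℂ S] (φ : Poly3 →ₐ[ℂ] S) (P : Poly3) :
    φ P = aeval ![φ (X 0), φ (X 1), φ (X 2)] P := by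
  have : φ = aeval ![φ (X 0), φ (X 1), φ (X 2)] := by
    ext i; fin_cases i <;> simp
  rw [← this]

/-- Only the variable y is moved. This one expansion serves Newton's method, the comparison of
nilpotently close points, and division by a conic. -/
lemma exists_taylor_second {S : Type*} [CommRing S] [Algebra ℂ S] (P : Poly3) (a b c y : S) :
    ∃ k : S, aeval ![a, b + y, c] P
      = aeval ![a, b, c] P + aeval ![a, b, c] (pderiv 1 P) * y + k * y ^ 2 := by
  induction P using MvPolynomial.induction_on with
  | C r => exact ⟨0, by simp⟩
  | add p q hp hq =>
    obtain ⟨k, hk⟩ := hp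
    obtain ⟨l, hl⟩ := hq
    exact ⟨k + l, by simp only [map_add, hk, hl]; ring⟩
  | mul_X p i hp =>
    obtain ⟨k, hk⟩ := hp
    fin_cases i
    · refine ⟨k * a, ?_⟩
      simp [hk, pderiv_X]; ring
    · refine ⟨aeval ![a, b, c] (pderiv 1 p) + k * (b + y), ?_⟩
      simp [hk, pderiv_X]; ring
    · refine ⟨k * c, ?_⟩
      simp [hk, pderiv_X]; ring

lemma euler_identity {P : Poly3} {d : ℕ} (hP : P.IsHomogeneous d) :
    X 0 * pderiv 0 P + X 1 * pderiv 1 P + X 2 * pderiv 2 P = d • P := by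
  rw [← hP.sum_X_mul_pderiv, Fin.sum_univ_three]

/-! ### Restriction to a graph -/

/-- The restriction of a form to the graph `y = q(x)` in the chart `z = 1`. -/
noncomputable def restrictGraph (q : Polynomial ℂ) : Poly3 →ₐ[ℂ] Polynomial ℂ :=
  aeval ![Polynomial.X, q, 1]

@[simp] lemma restrictGraph_X0 (q : Polynomial ℂ) : restrictGraph q (X 0) = Polynomial.X := by
  simp [restrictGraph]
@[simp] lemma restrictGraph_X1 (q : Polynomial ℂ) : restrictGraph q (X 1) = q := by
  simp [restrictGraph]
@[simp] lemma restrictGraph_X2 (q : Polynomial ℂ) : restrictGraph q (X 2) = 1 := by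
  simp [restrictGraph]
@[simp] lemma restrictGraph_C (q : Polynomial ℂ) (r : ℂ) :
    restrictGraph q (C r) = Polynomial.C r := by
  simp [restrictGraph]

lemma aeval_restrictGraph {S : Type*} [CommRing S] [Algebra ℂ S] (q : Polynomial ℂ) (u : S)
    (P : Poly3) :
    Polynomial.aeval u (restrictGraph q P) = aeval ![u, Polynomial.aeval u q, 1] P := by
  have := aeval_vec_three ((Polynomial.aeval u).comp (restrictGraph q)) P
  simpa using this

lemma eval_restrictGraph (q : Polynomial ℂ) (u : ℂ) (P : Poly3) :
    (restrictGraph q P).eval u = eval ![u, q.eval u, 1] P := by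
  have := aeval_restrictGraph q u P
  rwa [aeval_eq_eval, Polynomial.coe_aeval_eq_eval] at this

lemma derivative_restrictGraph (q : Polynomial ℂ) (P : Poly3) :
    (restrictGraph q P).derivative
      = restrictGraph q (pderiv 0 P) + restrictGraph q (pderiv 1 P) * q.derivative := by
  induction P using MvPolynomial.induction_on with
  | C r => simp
  | add p q hp hq => simp only [map_add, hp, hq]; ring
  | mul_X p i hp =>
    fin_cases i
    · simp [hp, pderiv_X]; ring
    · simp [hp, pderiv_X]; ring
    · simp [hp, pderiv_X]

lemma sub_dvd_restrictGraph_sub (q r : Polynomial ℂ) (P : Poly3) :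
    q - r ∣ restrictGraph q P - restrictGraph r P := by
  obtain ⟨k, hk⟩ := exists_taylor_second P Polynomial.X r 1 (q - r)
  rw [add_sub_cancel] at hk
  refine ⟨aeval ![Polynomial.X, r, 1] (pderiv 1 P) + k * (q - r), ?_⟩
  rw [restrictGraph, restrictGraph, hk]
  ring

/-- Newton's method: as ∂P/∂y ≠ 0 at the point, a root y = q(x) modulo one power of x - α lifts to
the next. -/
lemma exists_graph_dvd {P : Poly3} {α β : ℂ} (h0 : eval ![α, β, 1] P = 0)
    (h1 : eval ![α, β, 1] (pderiv 1 P) ≠ 0) (n : ℕ) :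
    ∃ q : Polynomial ℂ, q.eval α = β ∧ (Polynomial.X - Polynomial.C α) ^ n ∣ restrictGraph q P := by
  -- Starting from exponent 1, the corrections leave q(α) alone and their squares vanish to the next
  -- order.
  suffices H : ∀ n : ℕ, ∃ q : Polynomial ℂ, q.eval α = β ∧
      (Polynomial.X - Polynomial.C α) ^ (n + 1) ∣ restrictGraph q P by
    obtain ⟨q, hq, hd⟩ := H n
    exact ⟨q, hq, (pow_dvd_pow _ n.le_succ).trans hd⟩
  intro n
  induction n with
  | zero =>
    refine ⟨Polynomial.C β, by simp, ?_⟩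
    rw [zero_add, pow_one, Polynomial.dvd_iff_isRoot, Polynomial.IsRoot, eval_restrictGraph]
    simpa using h0
  | succ n ih =>
    obtain ⟨q, hq, r, hr⟩ := ih
    set l := Polynomial.X - Polynomial.C α with hl
    -- The root of the linearised equation r(α) + ∂P/∂y · t = 0.
    set t : ℂ := - r.eval α / eval ![α, β, 1] (pderiv 1 P)
    obtain ⟨k, hk⟩ := exists_taylor_second P Polynomial.X q 1 (l ^ (n + 1) * Polynomial.C t)
    have hroot : l ∣ r + restrictGraph q (pderiv 1 P) * Polynomial.C t := by
      rw [hl, Polynomial.dvd_iff_isRoot, Polynomial.IsRoot]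
      simp only [Polynomial.eval_add, Polynomial.eval_mul, eval_restrictGraph, hq,
        Polynomial.eval_C, t]
      field_simp
      ring
    obtain ⟨s, hs⟩ := hroot
    refine ⟨q + l ^ (n + 1) * Polynomial.C t, by simp [hq, hl],
      s + k * l ^ n * Polynomial.C t ^ 2, ?_⟩
    rw [restrictGraph, hk]
    change restrictGraph q P + restrictGraph q (pderiv 1 P) * _ + _ = _
    rw [hr]
    linear_combination l ^ (n + 1) * hs

/-! ### Points of the affine chart and orders -/

/-- The point `(α : β : 1)`. -/
noncomputable def affinePt (α β : ℂ) : Plane :=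
  Projectivization.mk ℂ ![α, β, 1] (fun h => one_ne_zero (α := ℂ) (congrFun h 2))

lemma affinePt_rep (α β : ℂ) : ∃ t : ℂ, t ≠ 0 ∧ (affinePt α β).rep = t • ![α, β, 1] := by
  obtain ⟨t, ht⟩ := Projectivization.exists_smul_eq_mk_rep ℂ ![α, β, 1]
    (fun h => one_ne_zero (α := ℂ) (congrFun h 2))
  exact ⟨t, t.ne_zero, ht.symm⟩

lemma inftyPt_rep : ∃ t : ℂ, t ≠ 0 ∧ inftyPt.rep = t • ![0, 1, 0] := by
  obtain ⟨t, ht⟩ := Projectivization.exists_smul_eq_mk_rep ℂ ![0, 1, 0]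
    (fun h => one_ne_zero (α := ℂ) (congrFun h 1))
  exact ⟨t, t.ne_zero, ht.symm⟩

lemma affinePt_inj {α β γ δ : ℂ} (h : affinePt α β = affinePt γ δ) : α = γ ∧ β = δ := by
  rw [affinePt, affinePt, Projectivization.mk_eq_mk_iff'] at h
  obtain ⟨t, ht⟩ := h
  have h0 := congrFun ht 0
  have h1 := congrFun ht 1
  have h2 := congrFun ht 2
  simp at h0 h1 h2
  subst h2
  simp at h0 h1
  exact ⟨h0.symm, h1.symm⟩

lemma affinePt_ne_inftyPt (α β : ℂ) : affinePt α β ≠ inftyPt := by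
  intro h
  rw [affinePt, inftyPt, Projectivization.mk_eq_mk_iff'] at h
  obtain ⟨t, ht⟩ := h
  have h2 := congrFun ht 2
  simp at h2

lemma eq_affinePt_of_rep_ne_zero {p : Plane} (hp : p.rep 2 ≠ 0) :
    p = affinePt (p.rep 0 / p.rep 2) (p.rep 1 / p.rep 2) := by
  conv_lhs => rw [← p.mk_rep]
  rw [affinePt, Projectivization.mk_eq_mk_iff']
  refine ⟨p.rep 2, ?_⟩
  ext i
  fin_cases i <;> simp [mul_div_cancel₀, hp]

lemma mem_curve_affinePt {F : Poly3} {d : ℕ} (hF : F.IsHomogeneous d) {α β : ℂ} :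
    affinePt α β ∈ curve F ↔ eval ![α, β, 1] F = 0 := by
  obtain ⟨t, ht, hr⟩ := affinePt_rep α β
  rw [curve, Set.mem_ofPred_eq, hr, eval_smul_of_isHomogeneous hF]
  simp [ht]

lemma mem_curve_inftyPt {F : Poly3} {d : ℕ} (hF : F.IsHomogeneous d) :
    inftyPt ∈ curve F ↔ eval ![0, 1, 0] F = 0 := by
  obtain ⟨t, ht, hr⟩ := inftyPt_rep
  rw [curve, Set.mem_ofPred_eq, hr, eval_smul_of_isHomogeneous hF]
  simp [ht]

lemma mem_orderIdeal_zero (F P : Poly3) (p : Plane) : P ∈ orderIdeal F p 0 := by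
  simp [orderIdeal]

lemma mem_orderIdeal_one {F P : Poly3} {p : Plane} (hp : p ∈ curve F) :
    P ∈ orderIdeal F p 1 ↔ p ∈ curve P := by
  have : orderIdeal F p 1 = pointIdeal p := by
    rw [orderIdeal, pow_one, sup_eq_right, Ideal.span_singleton_le_iff_mem]
    exact hp
  rw [this]
  rfl

lemma mem_orderIdeal_inftyPt {F P : Poly3} {d : ℕ} (hp : inftyPt ∈ curve F)
    (hP : P.IsHomogeneous d) : P ∈ orderIdeal F inftyPt 1 ↔ eval ![0, 1, 0] P = 0 := by
  rw [mem_orderIdeal_one hp, mem_curve_inftyPt hP]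

/-! ### Truncated local rings of the curve -/

section LocalRing

variable {F : Poly3} {p : Plane} {n : ℕ}

lemma mk_pow_eq_zero {P : Poly3} (hP : eval p.rep P = 0) :
    Ideal.Quotient.mkₐ ℂ (orderIdeal F p n) P ^ n = 0 := by
  rw [← map_pow, Ideal.Quotient.mkₐ_eq_mk, Ideal.Quotient.eq_zero_iff_mem]
  exact Ideal.mem_sup_right (Ideal.pow_mem_pow hP n)

lemma isUnit_mk {P : Poly3} (hP : eval p.rep P ≠ 0) :
    IsUnit (Ideal.Quotient.mkₐ ℂ (orderIdeal F p n) P) := by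
  have h : P = C (eval p.rep P) + (P - C (eval p.rep P)) := by ring
  rw [h, map_add]
  refine IsNilpotent.isUnit_add_left_of_commute ⟨n, mk_pow_eq_zero (by simp)⟩ ?_ (Commute.all _ _)
  exact ((isUnit_iff_ne_zero.2 hP).map C).map _

/-- In the local ring of order `n` at `(α : β : 1)` there are affine coordinates `u`, `w`. -/
lemma exists_affine_coordinates (F : Poly3) (α β : ℂ) (n : ℕ) :
    ∃ u w : Poly3 ⧸ orderIdeal F (affinePt α β) n,
      (u - algebraMap ℂ _ α) ^ n = 0 ∧ (w - algebraMap ℂ _ β) ^ n = 0 ∧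
      ∀ (P : Poly3) (d : ℕ), P.IsHomogeneous d →
        (P ∈ orderIdeal F (affinePt α β) n ↔ aeval ![u, w, 1] P = 0) := by
  obtain ⟨t, ht, hr⟩ := affinePt_rep α β
  set π := Ideal.Quotient.mkₐ ℂ (orderIdeal F (affinePt α β) n) with hπ
  -- Since z does not vanish at the point, it can be inverted: u = x/z and w = y/z.
  have hz : IsUnit (π (X 2)) := isUnit_mk (by simp [hr, ht])
  obtain ⟨s, hs⟩ := hz.exists_right_inv
  have key : ∀ (γ : ℂ) (i : Fin 3), eval (affinePt α β).rep (X i - C γ * X 2) = 0 →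
      (π (X i) * s - algebraMap ℂ _ γ) ^ n = 0 := by
    intro γ i h
    have h1 : π (X i) * s - algebraMap ℂ _ γ = π (X i - C γ * X 2) * s := by
      have : π (C γ) = algebraMap ℂ _ γ := by
        rw [← algebraMap_eq]; exact π.commutes γ
      rw [map_sub, map_mul, this]
      linear_combination (algebraMap ℂ (Poly3 ⧸ orderIdeal F (affinePt α β) n) γ) * hs
    rw [h1, mul_pow, mk_pow_eq_zero h, zero_mul]
  refine ⟨π (X 0) * s, π (X 1) * s, key α 0 (by simp [hr]; ring), key β 1 (by simp [hr]; ring),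
    fun P d hP => ?_⟩
  have h2 : π P = π (X 2) ^ d * aeval ![π (X 0) * s, π (X 1) * s, 1] P := by
    rw [← aeval_mul_of_isHomogeneous hP, aeval_vec_three π P]
    congr 2
    ext i
    fin_cases i
    · simp; linear_combination (-π (X 0)) * hs
    · simp; linear_combination (-π (X 1)) * hs
    · simp
  rw [← Ideal.Quotient.eq_zero_iff_mem, ← Ideal.Quotient.mkₐ_eq_mk ℂ, ← hπ, h2]
  exact (hz.pow d).mul_right_eq_zero

end LocalRing

lemma aeval_sub_nilpotent {S : Type*} [CommRing S] [Algebra ℂ S] {u : S} {α : ℂ}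
    (hu : IsNilpotent (u - algebraMap ℂ S α)) (g : Polynomial ℂ) :
    IsNilpotent (Polynomial.aeval u g - algebraMap ℂ S (g.eval α)) := by
  have h : Polynomial.X - Polynomial.C α ∣ g - Polynomial.C (g.eval α) := by
    rw [Polynomial.dvd_iff_isRoot]; simp
  obtain ⟨k, hk⟩ := h
  have h2 := congrArg (Polynomial.aeval u) hk
  simp only [map_sub, map_mul, Polynomial.aeval_C, Polynomial.aeval_X] at h2
  rw [h2]
  exact (Commute.all _ _).isNilpotent_mul_right hu

/-- By Euler's identity at z = 1, the vanishing of F, F_x and F_y forces that of F_z. -/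
lemma pderiv_ne_zero_of_affine {F : Poly3} {d : ℕ} (hF : F.IsHomogeneous d)
    (hns : IsNonsingularCurve F) {α β : ℂ} (h : eval ![α, β, 1] F = 0) :
    eval ![α, β, 1] (pderiv 0 F) ≠ 0 ∨ eval ![α, β, 1] (pderiv 1 F) ≠ 0 := by
  by_contra! H
  have e2 := congrArg (eval ![α, β, 1]) (euler_identity hF)
  simp [H.1, H.2, h] at e2
  obtain ⟨i, hi⟩ := hns ![α, β, 1] (fun h => one_ne_zero (α := ℂ) (congrFun h 2)) h
  fin_cases i
  · exact hi H.1
  · exact hi H.2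
  · exact hi e2

/-- By the chain rule F_x + F_y q' = 0 at a double contact, so F_y = 0 would give F_x = 0. -/
lemma pderiv_one_ne_zero_of_dvd {F : Poly3} {d : ℕ} (hF : F.IsHomogeneous d)
    (hns : IsNonsingularCurve F) {q : Polynomial ℂ} {α : ℂ}
    (h : (Polynomial.X - Polynomial.C α) ^ 2 ∣ restrictGraph q F) :
    eval ![α, q.eval α, 1] (pderiv 1 F) ≠ 0 := by
  intro h1
  obtain ⟨k, hk⟩ := h
  have e0 : eval ![α, q.eval α, 1] F = 0 := by
    rw [← eval_restrictGraph, hk]; simp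
  have e1 := congrArg (fun g => Polynomial.eval α (Polynomial.derivative g)) hk
  simp only [derivative_restrictGraph, Polynomial.eval_add, Polynomial.eval_mul,
    eval_restrictGraph, h1] at e1
  simp [Polynomial.derivative_pow] at e1
  exact (pderiv_ne_zero_of_affine hF hns e0).elim (· e1) (· h1)

/-- The order of a form at a point of a graph that has contact of order `n` with the curve there. -/
lemma mem_orderIdeal_iff_dvd {F : Poly3} {d : ℕ} (hF : F.IsHomogeneous d)
    (hns : IsNonsingularCurve F) {q : Polynomial ℂ} {α : ℂ} {n : ℕ}
    (h : (Polynomial.X - Polynomial.C α) ^ n ∣ restrictGraph q F) {P : Poly3} {e : ℕ}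
    (hP : P.IsHomogeneous e) :
    P ∈ orderIdeal F (affinePt α (q.eval α)) n ↔
      (Polynomial.X - Polynomial.C α) ^ n ∣ restrictGraph q P := by
  rcases Nat.lt_or_ge n 2 with hn | hn
  · interval_cases n
    · simp [mem_orderIdeal_zero]
    · simp only [pow_one, Polynomial.dvd_iff_isRoot, Polynomial.IsRoot, eval_restrictGraph] at h ⊢
      rw [mem_orderIdeal_one ((mem_curve_affinePt hF).2 h), mem_curve_affinePt hP]
  constructor
  · intro hmem
    obtain ⟨t, ht, hr⟩ := affinePt_rep α (q.eval α)
    -- The factor t makes the substitution hit the chosen representative exactly at x = α, so that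
    -- `pointIdeal` is sent into (x - α).
    set φ : Poly3 →ₐ[ℂ] Polynomial ℂ :=
      aeval (fun i => Polynomial.C t * ![Polynomial.X, q, 1] i) with hφ
    have hom : ∀ (Q : Poly3) (m : ℕ), Q.IsHomogeneous m →
        φ Q = Polynomial.C t ^ m * restrictGraph q Q := fun Q m hQ =>
      aeval_mul_of_isHomogeneous hQ _ _
    have hle : orderIdeal F (affinePt α (q.eval α)) n ≤
        (Ideal.span {(Polynomial.X - Polynomial.C α) ^ n}).comap φ := by
      rw [orderIdeal, sup_le_iff, Ideal.span_singleton_le_iff_mem, Ideal.mem_comap,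
        Ideal.mem_span_singleton, hom F d hF]
      refine ⟨h.mul_left _, ?_⟩
      rw [← Ideal.span_singleton_pow]
      refine le_trans (Ideal.pow_right_mono ?_ n) (Ideal.le_comap_pow φ n)
      intro Q hQ
      rw [Ideal.mem_comap, Ideal.mem_span_singleton, Polynomial.dvd_iff_isRoot, Polynomial.IsRoot]
      have h3 := aeval_vec_three ((Polynomial.aeval α).comp φ) Q
      simp only [AlgHom.comp_apply, Polynomial.coe_aeval_eq_eval] at h3
      rw [h3, aeval_eq_eval]
      have : ![Polynomial.eval α (φ (X 0)), Polynomial.eval α (φ (X 1)),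
          Polynomial.eval α (φ (X 2))] = (affinePt α (q.eval α)).rep := by
        rw [hr]; ext i; fin_cases i <;> simp [hφ]
      rw [this]
      exact hQ
    have h4 := hle hmem
    rw [Ideal.mem_comap, Ideal.mem_span_singleton, hom P e hP] at h4
    have hu : IsUnit (Polynomial.C t ^ e) := (Polynomial.isUnit_C.2 (isUnit_iff_ne_zero.2 ht)).pow e
    exact hu.dvd_mul_left.1 h4
  · rintro hdvd
    have hy := pderiv_one_ne_zero_of_dvd hF hns ((pow_dvd_pow _ hn).trans h)
    obtain ⟨u, w, hu, hw, hmem⟩ := exists_affine_coordinates F α (q.eval α) n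
    have hun : IsNilpotent (u - algebraMap ℂ _ α) := ⟨n, hu⟩
    have van : ∀ g : Polynomial ℂ, (Polynomial.X - Polynomial.C α) ^ n ∣ g →
        Polynomial.aeval u g = 0 := by
      rintro _ ⟨k, rfl⟩
      simp [hu]
    -- Both F(u, w) and F(u, q(u)) vanish; their difference is w - q(u) times F_y plus a nilpotent,
    -- which is a unit.
    have hwq : w = Polynomial.aeval u q := by
      have hF0 : aeval ![u, w, 1] F = 0 :=
        (hmem F d hF).1 (Ideal.mem_sup_left (Ideal.mem_span_singleton_self F))
      obtain ⟨k, hk⟩ := exists_taylor_second F u (Polynomial.aeval u q) 1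
        (w - Polynomial.aeval u q)
      rw [add_sub_cancel, hF0, ← aeval_restrictGraph, ← aeval_restrictGraph, van _ h] at hk
      have hnil : IsNilpotent (w - Polynomial.aeval u q) := by
        have := (Commute.all _ _).isNilpotent_sub ⟨n, hw⟩ (aeval_sub_nilpotent hun q)
        simpa using this
      have hunit : IsUnit (Polynomial.aeval u (restrictGraph q (pderiv 1 F))
          + k * (w - Polynomial.aeval u q)) := by
        refine IsNilpotent.isUnit_add_left_of_commute
          ((Commute.all _ _).isNilpotent_mul_left hnil) ?_ (Commute.all _ _)
        have h5 := aeval_sub_nilpotent hun (restrictGraph q (pderiv 1 F))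
        rw [← sub_add_cancel (Polynomial.aeval u (restrictGraph q (pderiv 1 F)))
          (algebraMap ℂ _ ((restrictGraph q (pderiv 1 F)).eval α)), add_comm]
        refine IsNilpotent.isUnit_add_left_of_commute h5 ?_ (Commute.all _ _)
        rw [eval_restrictGraph]
        exact (isUnit_iff_ne_zero.2 hy).map _
      rw [← sub_eq_zero, ← hunit.mul_right_eq_zero, hk]
      ring
    rw [hmem P e hP, hwq, ← aeval_restrictGraph, van _ hdvd]

/-! ### Explicit lines and conics -/

lemma exists_eq_line {P : Poly3} (hP : P.IsHomogeneous 1) :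
    ∃ l0 l1 l2 : ℂ, P = C l0 * X 2 + C l1 * X 0 + C l2 * X 1 := by
  obtain ⟨c, hc⟩ := exists_eq_sum_of_isHomogeneous hP
  refine ⟨c 0 0, c 1 0, c 0 1, hc.trans ?_⟩
  simp [Finset.sum_range_succ]
  ring

/-- The general quadratic form. -/
noncomputable def conic (e : Fin 6 → ℂ) : Poly3 :=
  C (e 0) * X 2 ^ 2 + C (e 1) * (X 0 * X 2) + C (e 2) * (X 1 * X 2) + C (e 3) * X 0 ^ 2
    + C (e 4) * (X 0 * X 1) + C (e 5) * X 1 ^ 2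

lemma exists_eq_conic {P : Poly3} (hP : P.IsHomogeneous 2) : ∃ e, P = conic e := by
  obtain ⟨c, hc⟩ := exists_eq_sum_of_isHomogeneous hP
  refine ⟨![c 0 0, c 1 0, c 0 1, c 2 0, c 1 1, c 0 2], hc.trans ?_⟩
  simp [Finset.sum_range_succ, conic]
  ring

lemma conic_eq_zero {e : Fin 6 → ℂ} (h : conic e = 0) : e = 0 := by
  have h0 := congrArg (eval ![0, 0, 1]) h
  have h1 := congrArg (eval ![1, 0, 1]) h
  have h2 := congrArg (eval ![0, 1, 1]) h
  have h3 := congrArg (eval ![1, 0, 0]) h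
  have h4 := congrArg (eval ![1, 1, 0]) h
  have h5 := congrArg (eval ![0, 1, 0]) h
  simp [conic] at h0 h1 h2 h3 h4 h5
  ext i
  fin_cases i <;> simp [h0, h3, h5] at *
  · exact h1
  · exact h2
  · exact h4

/-- The conic `a₀₀ + a₁₀ x + a₀₁ y - x²`. -/
noncomputable def conicA (a : Fin 3 → ℂ) : Poly3 :=
  C (a 0) * X 2 ^ 2 + C (a 1) * (X 0 * X 2) + C (a 2) * (X 1 * X 2) - X 0 ^ 2

/-- The conic `b₀₀ + b₁₀ x + b₀₁ y - x y`. -/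
noncomputable def conicB (b : Fin 3 → ℂ) : Poly3 :=
  C (b 0) * X 2 ^ 2 + C (b 1) * (X 0 * X 2) + C (b 2) * (X 1 * X 2) - X 0 * X 1

lemma isHomogeneous_conicA (a : Fin 3 → ℂ) : (conicA a).IsHomogeneous 2 := by
  have h (i j : Fin 3) : (X i * X j : Poly3).IsHomogeneous 2 :=
    (isHomogeneous_X _ i).mul (isHomogeneous_X _ j)
  rw [conicA, sq, sq]
  exact ((((h 2 2).C_mul _).add ((h 0 2).C_mul _)).add ((h 1 2).C_mul _)).sub (h 0 0)

lemma isHomogeneous_conicB (b : Fin 3 → ℂ) : (conicB b).IsHomogeneous 2 := by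
  have h (i j : Fin 3) : (X i * X j : Poly3).IsHomogeneous 2 :=
    (isHomogeneous_X _ i).mul (isHomogeneous_X _ j)
  rw [conicB, sq]
  exact ((((h 2 2).C_mul _).add ((h 0 2).C_mul _)).add ((h 1 2).C_mul _)).sub (h 0 1)

/-- `conicB` has no x² term and `conicA` no xy term, so these two coefficients force s = 1 and t =
0. -/
lemma conicA_combination {a a' b : Fin 3 → ℂ} {s t : ℂ}
    (h : s • conicA a + t • conicB b = conicA a') : a' = a := by
  have hz : conic ![s * a 0 + t * b 0 - a' 0, s * a 1 + t * b 1 - a' 1,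
      s * a 2 + t * b 2 - a' 2, 1 - s, -t, 0] = 0 := by
    rw [← sub_eq_zero] at h
    rw [← h]
    simp [conic, conicA, conicB, smul_eq_C_mul]
    ring
  have e := conic_eq_zero hz
  have e3 := congrFun e 3
  have e4 := congrFun e 4
  simp [sub_eq_zero] at e3 e4
  subst e3 e4
  ext i
  fin_cases i
  · have := congrFun e 0
    simp at this
    exact (sub_eq_zero.1 this).symm
  · have := congrFun e 1
    simp at this
    exact (sub_eq_zero.1 this).symm
  · have := congrFun e 2
    simp at this
    exact (sub_eq_zero.1 this).symm

lemma conicB_combination {a b b' : Fin 3 → ℂ} {s t : ℂ}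
    (h : s • conicA a + t • conicB b = conicB b') : b' = b := by
  have hz : conic ![s * a 0 + t * b 0 - b' 0, s * a 1 + t * b 1 - b' 1,
      s * a 2 + t * b 2 - b' 2, -s, 1 - t, 0] = 0 := by
    rw [← sub_eq_zero] at h
    rw [← h]
    simp [conic, conicA, conicB, smul_eq_C_mul]
    ring
  have e := conic_eq_zero hz
  have e3 := congrFun e 3
  have e4 := congrFun e 4
  simp [sub_eq_zero] at e3 e4
  subst e3 e4
  ext i
  fin_cases i
  · have := congrFun e 0
    simp at this
    exact (sub_eq_zero.1 this).symm
  · have := congrFun e 1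
    simp at this
    exact (sub_eq_zero.1 this).symm
  · have := congrFun e 2
    simp at this
    exact (sub_eq_zero.1 this).symm

/-- The conic `a₀₀ + a₁₀ x + a₀₁ y = x²` is the graph of this polynomial. -/
noncomputable def parabola (a : Fin 3 → ℂ) : Polynomial ℂ :=
  Polynomial.C (a 2)⁻¹ * Polynomial.X ^ 2 + Polynomial.C (-(a 1 / a 2)) * Polynomial.X
    + Polynomial.C (-(a 0 / a 2))

lemma natDegree_parabola {a : Fin 3 → ℂ} (ha : a 2 ≠ 0) : (parabola a).natDegree = 2 :=
  Polynomial.natDegree_quadratic (inv_ne_zero ha)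

lemma C_mul_parabola {a : Fin 3 → ℂ} (ha : a 2 ≠ 0) :
    Polynomial.C (a 2) * parabola a = Polynomial.X ^ 2 - Polynomial.C (a 1) * Polynomial.X
      - Polynomial.C (a 0) := by
  have h1 : Polynomial.C (a 2) * Polynomial.C (a 2)⁻¹ = 1 := by
    rw [← Polynomial.C_mul, mul_inv_cancel₀ ha, Polynomial.C_1]
  have h2 (r : ℂ) : Polynomial.C (a 2) * Polynomial.C (-(r / a 2)) = - Polynomial.C r := by
    rw [← Polynomial.C_mul, ← Polynomial.C_neg]; congr 1; field_simp
  rw [parabola]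
  linear_combination Polynomial.X ^ 2 * h1 + Polynomial.X * h2 (a 1) + h2 (a 0)

lemma restrictGraph_conicA {a : Fin 3 → ℂ} (ha : a 2 ≠ 0) :
    restrictGraph (parabola a) (conicA a) = 0 := by
  have := C_mul_parabola ha
  simp only [conicA, map_sub, map_add, map_mul, map_pow, restrictGraph_C, restrictGraph_X0,
    restrictGraph_X1, restrictGraph_X2]
  linear_combination this

lemma natDegree_restrictGraph_conicB {a b : Fin 3 → ℂ} (ha : a 2 ≠ 0) :
    (restrictGraph (parabola a) (conicB b)).natDegree = 3 := by
  have h : restrictGraph (parabola a) (conicB b) =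
      Polynomial.C (-(a 2)⁻¹) * Polynomial.X ^ 3
        + Polynomial.C (b 2 * (a 2)⁻¹ + a 1 / a 2) * Polynomial.X ^ 2
        + Polynomial.C (b 1 + b 2 * -(a 1 / a 2) + a 0 / a 2) * Polynomial.X
        + Polynomial.C (b 0 + b 2 * -(a 0 / a 2)) := by
    simp [conicB, parabola]
    ring
  rw [h]
  exact Polynomial.natDegree_cubic (neg_ne_zero.2 (inv_ne_zero ha))

/-- The combination has degree at most 2, too small for a cubic divisor, and 1, x, q are
independent. -/
lemma eq_zero_of_dvd_combination {c q : Polynomial ℂ} (hc : c.natDegree = 3) (hq : q.natDegree = 2)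
    {e0 e1 e2 : ℂ} (h : c ∣ Polynomial.C e0 + Polynomial.C e1 * Polynomial.X + Polynomial.C e2 * q) :
    e0 = 0 ∧ e1 = 0 ∧ e2 = 0 := by
  have hz := Polynomial.eq_zero_of_dvd_of_natDegree_lt h (by
    rw [hc]
    refine lt_of_le_of_lt ?_ (by norm_num : 2 < 3)
    refine Polynomial.natDegree_add_le_of_degree_le (Polynomial.natDegree_add_le_of_degree_le
      (by simp) ?_) ((Polynomial.natDegree_C_mul_le _ _).trans hq.le)
    exact (Polynomial.natDegree_C_mul_le _ _).trans (by simp))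
  have h2 := congrArg (Polynomial.coeff · 2) hz
  have hq2 : q.coeff 2 ≠ 0 := by
    rw [← hq]
    exact Polynomial.leadingCoeff_ne_zero.2 (by rintro rfl; simp at hq)
  have e2z : e2 = 0 := by
    simpa [Polynomial.coeff_C, Polynomial.coeff_X, hq2] using h2
  subst e2z
  have h0 := congrArg (Polynomial.coeff · 0) hz
  have h1 := congrArg (Polynomial.coeff · 1) hz
  simp at h0
  simp [Polynomial.coeff_C] at h1
  exact ⟨h0, h1, rfl⟩

/-! ### Divisors on a graph -/

open Classical in
/-- The divisor on the graph `y = q(x)` that `c(x) = 0` cuts out. -/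
noncomputable def graphDivisor (q c : Polynomial ℂ) : Plane →₀ ℕ :=
  Multiset.toFinsupp (c.roots.map fun α => affinePt α (q.eval α))

lemma graphDivisor_affinePt (q c : Polynomial ℂ) (α : ℂ) :
    graphDivisor q c (affinePt α (q.eval α)) = c.rootMultiplicity α := by
  classical
  rw [graphDivisor, Multiset.toFinsupp_apply, Multiset.count_map_eq_count'
    (fun α => affinePt α (q.eval α)) c.roots (fun β γ h => (affinePt_inj h).1) α,
    Polynomial.count_roots]

lemma exists_of_mem_support_graphDivisor {q c : Polynomial ℂ} {p : Plane}
    (hp : p ∈ (graphDivisor q c).support) : ∃ α, c.IsRoot α ∧ p = affinePt α (q.eval α) := by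
  classical
  rw [graphDivisor, Multiset.toFinsupp_support, Multiset.mem_toFinset, Multiset.mem_map] at hp
  obtain ⟨α, hα, rfl⟩ := hp
  exact ⟨α, Polynomial.isRoot_of_mem_roots hα, rfl⟩

lemma graphDivisor_inftyPt (q c : Polynomial ℂ) : graphDivisor q c inftyPt = 0 := by
  by_contra h
  obtain ⟨α, -, h⟩ := exists_of_mem_support_graphDivisor (Finsupp.mem_support_iff.2 h)
  exact affinePt_ne_inftyPt _ _ h.symm

lemma degree_graphDivisor (q c : Polynomial ℂ) : (graphDivisor q c).degree = c.natDegree := by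
  classical
  rw [← IsAlgClosed.card_roots_eq_natDegree, ← Multiset.card_map (fun α => affinePt α (q.eval α)),
    ← Multiset.toFinsupp_sum_eq]
  rfl

lemma dvd_iff_forall_pow_rootMultiplicity_dvd {c g : Polynomial ℂ} (hc : c ≠ 0) :
    c ∣ g ↔ ∀ α, (Polynomial.X - Polynomial.C α) ^ c.rootMultiplicity α ∣ g := by
  classical
  refine ⟨fun h α => (Polynomial.pow_rootMultiplicity_dvd c α).trans h, fun h => ?_⟩
  rcases eq_or_ne g 0 with rfl | hg
  · exact dvd_zero c
  refine (IsAlgClosed.splits c).dvd_of_roots_le_roots hc (Multiset.le_iff_count.2 fun α => ?_)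
  rw [Polynomial.count_roots, Polynomial.count_roots, Polynomial.le_rootMultiplicity_iff hg]
  exact h α

lemma mem_formsThrough {F P : Poly3} {e : ℕ} {D : Plane →₀ ℕ} :
    P ∈ formsThrough F e D ↔ P.IsHomogeneous e ∧ ∀ p, P ∈ orderIdeal F p (D p) := by
  simp [formsThrough, mem_homogeneousSubmodule]

section GraphDivisor

variable {F : Poly3} {d : ℕ} (hF : F.IsHomogeneous d) (hns : IsNonsingularCurve F)
  {q c : Polynomial ℂ} (hc : c ≠ 0) (h : c ∣ restrictGraph q F)
include hF hns hc h

lemma mem_formsThrough_graphDivisor {P : Poly3} {e : ℕ} :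
    P ∈ formsThrough F e (graphDivisor q c) ↔ P.IsHomogeneous e ∧ c ∣ restrictGraph q P := by
  rw [mem_formsThrough]
  refine and_congr_right fun hP => ?_
  have key (α : ℂ) : P ∈ orderIdeal F (affinePt α (q.eval α))
      (graphDivisor q c (affinePt α (q.eval α))) ↔
      (Polynomial.X - Polynomial.C α) ^ c.rootMultiplicity α ∣ restrictGraph q P := by
    rw [graphDivisor_affinePt]
    exact mem_orderIdeal_iff_dvd hF hns ((Polynomial.pow_rootMultiplicity_dvd c α).trans h) hP
  rw [dvd_iff_forall_pow_rootMultiplicity_dvd hc]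
  refine ⟨fun H α => (key α).1 (H _), fun H p => ?_⟩
  by_cases hp : p ∈ (graphDivisor q c).support
  · obtain ⟨α, -, rfl⟩ := exists_of_mem_support_graphDivisor hp
    exact (key α).2 (H α)
  · rw [Finsupp.notMem_support_iff.1 hp]
    exact mem_orderIdeal_zero F P p

lemma mem_formsThrough_graphDivisor_add_inftyPt (hinf : inftyPt ∈ curve F) {P : Poly3} {e : ℕ} :
    P ∈ formsThrough F e (graphDivisor q c + Finsupp.single inftyPt 1) ↔
      P.IsHomogeneous e ∧ c ∣ restrictGraph q P ∧ eval ![0, 1, 0] P = 0 := by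
  rw [← and_assoc, ← mem_formsThrough_graphDivisor hF hns hc h, mem_formsThrough, mem_formsThrough,
    and_assoc]
  refine and_congr_right fun hP => ?_
  rw [← mem_orderIdeal_inftyPt hinf hP]
  classical
  constructor
  · refine fun H => ⟨fun p => ?_, ?_⟩
    · by_cases hp : p = inftyPt
      · rw [hp, graphDivisor_inftyPt]
        exact mem_orderIdeal_zero F P _
      · simpa [Finsupp.single_apply, Ne.symm hp] using H p
    · simpa [graphDivisor_inftyPt] using H inftyPt
  · rintro ⟨H, H0⟩ p
    by_cases hp : p = inftyPt
    · simpa [hp, graphDivisor_inftyPt] using H0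
    · simpa [Finsupp.single_apply, Ne.symm hp] using H p

end GraphDivisor

/-! ### Pencils of conics and their divisors -/

section Parabola

variable {F : Poly3} (hF : F.IsHomogeneous 4) (hns : IsNonsingularCurve F)
  (hinf : inftyPt ∈ curve F) {a b : Fin 3 → ℂ} (ha : a 2 ≠ 0)
  (h : restrictGraph (parabola a) (conicB b) ∣ restrictGraph (parabola a) F)

/-- The divisor that `conicB b` cuts out on the affine part of the conic `conicA a`. -/
noncomputable def conicDivisor (a b : Fin 3 → ℂ) : Plane →₀ ℕ :=
  graphDivisor (parabola a) (restrictGraph (parabola a) (conicB b))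

include ha in
lemma restrictGraph_conicB_ne_zero : restrictGraph (parabola a) (conicB b) ≠ 0 := by
  intro h0
  have := natDegree_restrictGraph_conicB (b := b) ha
  simp [h0] at this

include hF hns hinf ha h

lemma span_conics_eq_formsThrough :
    Submodule.span ℂ {conicA a, conicB b} =
      formsThrough F 2 (conicDivisor a b + Finsupp.single inftyPt 1) := by
  have key {P : Poly3} := mem_formsThrough_graphDivisor_add_inftyPt (P := P) (e := 2) hF hns
    (restrictGraph_conicB_ne_zero ha) h hinf
  rw [← conicDivisor] at key
  refine le_antisymm (Submodule.span_le.2 ?_) fun P hP => ?_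
  · rintro P (rfl | rfl)
    · refine key.2 ⟨isHomogeneous_conicA a, ?_, by simp [conicA]⟩
      rw [restrictGraph_conicA ha]
      exact dvd_zero _
    · exact key.2 ⟨isHomogeneous_conicB b, dvd_rfl, by simp [conicB]⟩
  · obtain ⟨hh, hd, h5⟩ := key.1 hP
    obtain ⟨e, rfl⟩ := exists_eq_conic hh
    have he5 : e 5 = 0 := by simpa [conic] using h5
    have hd2 := dvd_add hd (((dvd_refl (restrictGraph (parabola a) (conicB b))).mul_left
      (Polynomial.C (e 4))))
    -- On the parabola, x² is replaced using A and xy using B; what remains is a combination of 1, x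
    -- and q, which the cubic can divide only if it is zero.
    have hsum : restrictGraph (parabola a) (conic e)
        + Polynomial.C (e 4) * restrictGraph (parabola a) (conicB b) =
        Polynomial.C (e 0 + e 3 * a 0 + e 4 * b 0)
        + Polynomial.C (e 1 + e 3 * a 1 + e 4 * b 1) * Polynomial.X
        + Polynomial.C (e 2 + e 3 * a 2 + e 4 * b 2) * parabola a := by
      have hA := C_mul_parabola ha
      simp [conic, conicB, he5]
      linear_combination (-Polynomial.C (e 3)) * hA
    rw [hsum] at hd2
    obtain ⟨z0, z1, z2⟩ := eq_zero_of_dvd_combination (natDegree_restrictGraph_conicB ha)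
      (natDegree_parabola ha) hd2
    rw [Submodule.mem_span_pair]
    refine ⟨-e 3, -e 4, ?_⟩
    have w0 := congrArg (C (σ := Fin 3)) z0
    have w1 := congrArg (C (σ := Fin 3)) z1
    have w2 := congrArg (C (σ := Fin 3)) z2
    simp only [C_add, C_mul, C_0] at w0 w1 w2
    simp only [conic, conicA, conicB, smul_eq_C_mul, he5, C_neg, C_0]
    linear_combination (-X 2 ^ 2) * w0 - X 0 * X 2 * w1 - X 1 * X 2 * w2

/-- A line restricts to degree at most 2 on the parabola, so the cubic cannot divide it. A line
through ∞ has no y term, so it restricts to degree at most 1 and cannot contain two points of the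
divisor. -/
lemma conicDivisor_mem_Div30 : conicDivisor a b ∈ Div30 F := by
  classical
  have hc := restrictGraph_conicB_ne_zero (b := b) ha
  have hpt (α : ℂ) := (Polynomial.pow_rootMultiplicity_dvd
    (restrictGraph (parabola a) (conicB b)) α).trans h
  refine ⟨fun p hp => ?_, ?_, graphDivisor_inftyPt _ _, ?_, fun p r hpr => ?_⟩
  · obtain ⟨α, hα, rfl⟩ := exists_of_mem_support_graphDivisor hp
    rw [mem_curve_affinePt hF, ← eval_restrictGraph]
    exact hα.dvd h
  · rw [conicDivisor, degree_graphDivisor, natDegree_restrictGraph_conicB ha]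
  · rw [NotCollinear, Submodule.eq_bot_iff]
    intro P hP
    obtain ⟨hh, hd⟩ := (mem_formsThrough_graphDivisor hF hns hc h).1 hP
    obtain ⟨l0, l1, l2, rfl⟩ := exists_eq_line hh
    obtain ⟨rfl, rfl, rfl⟩ := eq_zero_of_dvd_combination (natDegree_restrictGraph_conicB ha)
      (natDegree_parabola ha) (by simpa using hd)
    simp
  · rw [NotCollinear, Submodule.eq_bot_iff]
    intro P hP
    obtain ⟨hh, ho⟩ := mem_formsThrough.1 hP
    obtain ⟨l0, l1, l2, rfl⟩ := exists_eq_line hh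
    have hps : p ∈ (conicDivisor a b).support := by
      rw [Finsupp.mem_support_iff]
      have := hpr p
      simp at this
      omega
    have hrs : r ∈ (conicDivisor a b).support := by
      rw [Finsupp.mem_support_iff]
      have := hpr r
      simp at this
      omega
    obtain ⟨α, -, rfl⟩ := exists_of_mem_support_graphDivisor hps
    obtain ⟨β, -, rfl⟩ := exists_of_mem_support_graphDivisor hrs
    have hle (n : ℕ) (γ : ℂ) (hn : n ≤ conicDivisor a b (affinePt γ ((parabola a).eval γ))) :
        (Polynomial.X - Polynomial.C γ) ^ n ∣ restrictGraph (parabola a) F := by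
      rw [conicDivisor, graphDivisor_affinePt] at hn
      exact (pow_dvd_pow _ hn).trans (hpt γ)
    have hl2 : l2 = 0 := by
      have := ho inftyPt
      simp only [Finsupp.add_apply, Finsupp.single_apply, affinePt_ne_inftyPt, if_false, if_true,
        zero_add] at this
      simpa using (mem_orderIdeal_inftyPt hinf hh).1 this
    subst hl2
    have hdvd : (Polynomial.X - Polynomial.C α) * (Polynomial.X - Polynomial.C β) ∣
        restrictGraph (parabola a) (C l0 * X 2 + C l1 * X 0 + C 0 * X 1) := by
      by_cases hab : α = β
      · subst hab
        have h2 : 2 ≤ conicDivisor a b (affinePt α ((parabola a).eval α)) := by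
          simpa using hpr (affinePt α ((parabola a).eval α))
        rw [← sq, ← mem_orderIdeal_iff_dvd hF hns (hle 2 α h2) hh]
        simpa [Finsupp.single_apply, (affinePt_ne_inftyPt _ _).symm] using
          ho (affinePt α ((parabola a).eval α))
      · have hne : affinePt α ((parabola a).eval α) ≠ affinePt β ((parabola a).eval β) :=
          fun h => hab (affinePt_inj h).1
        refine IsCoprime.mul_dvd (Polynomial.isCoprime_X_sub_C_of_isUnit_sub
          (isUnit_iff_ne_zero.2 (sub_ne_zero.2 hab))) ?_ ?_
        · have h1 := ho (affinePt α ((parabola a).eval α))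
          simp [(affinePt_ne_inftyPt _ _).symm, hne.symm] at h1
          rw [← pow_one (Polynomial.X - Polynomial.C α)]
          refine (mem_orderIdeal_iff_dvd hF hns (hle 1 α ?_) hh).1 (by simpa using h1)
          simpa [Finsupp.single_apply, hne.symm] using hpr (affinePt α ((parabola a).eval α))
        · have h1 := ho (affinePt β ((parabola a).eval β))
          simp [(affinePt_ne_inftyPt _ _).symm, hne] at h1
          rw [← pow_one (Polynomial.X - Polynomial.C β)]
          refine (mem_orderIdeal_iff_dvd hF hns (hle 1 β ?_) hh).1 (by simpa using h1)
          simpa [Finsupp.single_apply, hne] using hpr (affinePt β ((parabola a).eval β))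
    have hz := Polynomial.eq_zero_of_dvd_of_natDegree_lt hdvd (by
      rw [Polynomial.natDegree_mul (Polynomial.X_sub_C_ne_zero _) (Polynomial.X_sub_C_ne_zero _)]
      simp only [Polynomial.natDegree_X_sub_C]
      refine lt_of_le_of_lt ?_ (by norm_num : 1 < 1 + 1)
      simp only [map_add, map_mul, restrictGraph_C, restrictGraph_X0, restrictGraph_X2,
        mul_one, map_zero, zero_mul, add_zero]
      rw [add_comm]
      exact Polynomial.natDegree_linear_le)
    have h0 := congrArg (Polynomial.coeff · 0) hz
    have h1 := congrArg (Polynomial.coeff · 1) hz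
    simp at h0
    simp [Polynomial.coeff_C] at h1
    simp [h0, h1]

end Parabola

/-! ### Every divisor of `Div30` lies on a parabola -/

lemma verticalLine_ne_zero (α : ℂ) : (X 0 - C α * X 2 : Poly3) ≠ 0 := by
  intro h
  simpa using congrArg (eval ![1, 0, 0]) h

lemma isHomogeneous_verticalLine (α : ℂ) : (X 0 - C α * X 2 : Poly3).IsHomogeneous 1 :=
  (isHomogeneous_X _ 0).sub (isHomogeneous_C_mul_X _ _)

/-- The tangent is vertical. Modulo order 2, (w - β)² = 0 and F(u, w) = 0 becomes (u - α) times a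
unit with constant term F_x ≠ 0. -/
lemma verticalLine_mem_orderIdeal_two {F : Poly3} {d : ℕ} (hF : F.IsHomogeneous d)
    (hns : IsNonsingularCurve F) {α β : ℂ} (h0 : eval ![α, β, 1] F = 0)
    (h1 : eval ![α, β, 1] (pderiv 1 F) = 0) :
    (X 0 - C α * X 2 : Poly3) ∈ orderIdeal F (affinePt α β) 2 := by
  obtain ⟨u, w, hu, hw, hmem⟩ := exists_affine_coordinates F α β 2
  have hun : IsNilpotent (u - algebraMap ℂ _ α) := ⟨2, hu⟩
  have hF0 : aeval ![u, w, 1] F = 0 :=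
    (hmem F d hF).1 (Ideal.mem_sup_left (Ideal.mem_span_singleton_self F))
  obtain ⟨k, hk⟩ := exists_taylor_second F u (Polynomial.aeval u (Polynomial.C β)) 1
    (w - algebraMap ℂ _ β)
  rw [← aeval_restrictGraph, ← aeval_restrictGraph, Polynomial.aeval_C, add_sub_cancel, hF0,
    hw] at hk
  have hd : ∀ P : Poly3, eval ![α, β, 1] P = 0 →
      Polynomial.X - Polynomial.C α ∣ restrictGraph (Polynomial.C β) P := fun P hP => by
    rw [Polynomial.dvd_iff_isRoot, Polynomial.IsRoot, eval_restrictGraph]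
    simpa using hP
  obtain ⟨f, hf⟩ := hd F h0
  obtain ⟨g, hg⟩ := hd _ h1
  have hfα : f.eval α ≠ 0 := by
    have h2 := congrArg (fun g => Polynomial.eval α (Polynomial.derivative g)) hf
    simp only [derivative_restrictGraph, Polynomial.eval_add, Polynomial.eval_mul,
      eval_restrictGraph] at h2
    simp at h2
    rw [← h2]
    exact (pderiv_ne_zero_of_affine hF hns h0).resolve_right (not_not.2 h1)
  have hunit : IsUnit (Polynomial.aeval u f + Polynomial.aeval u g * (w - algebraMap ℂ _ β)) := by
    refine IsNilpotent.isUnit_add_left_of_commute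
      ((Commute.all _ _).isNilpotent_mul_left ⟨2, hw⟩) ?_ (Commute.all _ _)
    rw [← sub_add_cancel (Polynomial.aeval u f) (algebraMap ℂ _ (f.eval α)), add_comm]
    exact IsNilpotent.isUnit_add_left_of_commute (aeval_sub_nilpotent hun f)
      ((isUnit_iff_ne_zero.2 hfα).map _) (Commute.all _ _)
  rw [hf, hg] at hk
  simp only [map_mul, map_sub, Polynomial.aeval_X, Polynomial.aeval_C] at hk
  rw [hmem _ 1 (isHomogeneous_verticalLine α)]
  simp only [map_sub, map_mul, aeval_X, ← algebraMap_eq, AlgHom.commutes]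
  simp only [Matrix.cons_val, mul_one]
  rw [← hunit.mul_left_eq_zero]
  linear_combination -hk

section Div30

variable {F : Poly3} {d : ℕ} (hF : F.IsHomogeneous d) (hns : IsNonsingularCurve F)
  (hinf : inftyPt ∈ curve F) {D : Plane →₀ ℕ} (hD : D ∈ Div30 F) {α β γ : ℂ}
include hinf hD

/-- Otherwise the vertical line x = α would contain both points and ∞. -/
lemma eq_of_mem_support_Div30 (hp : affinePt α β ∈ D.support) (hr : affinePt α γ ∈ D.support) :
    β = γ := by
  classical
  by_contra hne
  have hpr : affinePt α β ≠ affinePt α γ := fun h => hne (affinePt_inj h).2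
  rw [Finsupp.mem_support_iff] at hp hr
  have hle : Finsupp.single (affinePt α β) 1 + Finsupp.single (affinePt α γ) 1 ≤ D := by
    intro x
    rcases eq_or_ne x (affinePt α β) with rfl | h1
    · simp [hpr.symm]; omega
    · rcases eq_or_ne x (affinePt α γ) with rfl | h2
      · simp [hpr]; omega
      · simp [Ne.symm h1, Ne.symm h2]
  have hnc := hD.2.2.2.2 _ _ hle
  rw [NotCollinear, Submodule.eq_bot_iff] at hnc
  refine verticalLine_ne_zero α (hnc _ (mem_formsThrough.2 ⟨isHomogeneous_verticalLine α, ?_⟩))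
  intro x
  have hcurve : ∀ δ, affinePt α δ ∈ curve (X 0 - C α * X 2 : Poly3) := fun δ => by
    rw [mem_curve_affinePt (isHomogeneous_verticalLine α)]; simp
  rcases eq_or_ne x (affinePt α β) with rfl | h1
  · simpa [hpr.symm, (affinePt_ne_inftyPt _ _).symm] using
      (mem_orderIdeal_one (hD.1 _ (Finsupp.mem_support_iff.2 hp))).2 (hcurve β)
  rcases eq_or_ne x (affinePt α γ) with rfl | h2
  · simpa [hpr, (affinePt_ne_inftyPt _ _).symm] using
      (mem_orderIdeal_one (hD.1 _ (Finsupp.mem_support_iff.2 hr))).2 (hcurve γ)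
  rcases eq_or_ne x inftyPt with rfl | h3
  · simpa [affinePt_ne_inftyPt] using (mem_orderIdeal_inftyPt hinf
      (isHomogeneous_verticalLine α)).2 (by simp)
  · simpa [Ne.symm h1, Ne.symm h2, Ne.symm h3] using mem_orderIdeal_zero F _ x

include hF hns

/-- A vertical tangent at p would make 2p + ∞ collinear. -/
lemma pderiv_one_ne_zero_of_Div30 (hp : 2 ≤ D (affinePt α β)) :
    eval ![α, β, 1] (pderiv 1 F) ≠ 0 := by
  classical
  intro h1
  have hle : Finsupp.single (affinePt α β) 1 + Finsupp.single (affinePt α β) 1 ≤ D := by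
    intro x
    rcases eq_or_ne x (affinePt α β) with rfl | h1
    · simpa using hp
    · simp [Ne.symm h1]
  have hnc := hD.2.2.2.2 _ _ hle
  rw [NotCollinear, Submodule.eq_bot_iff] at hnc
  refine verticalLine_ne_zero α (hnc _ (mem_formsThrough.2 ⟨isHomogeneous_verticalLine α, ?_⟩))
  intro x
  rcases eq_or_ne x (affinePt α β) with rfl | h2
  · have h0 : eval ![α, β, 1] F = 0 := (mem_curve_affinePt hF).1
      (hD.1 _ (Finsupp.mem_support_iff.2 (by omega)))
    simpa [(affinePt_ne_inftyPt _ _).symm] using verticalLine_mem_orderIdeal_two hF hns h0 h1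
  rcases eq_or_ne x inftyPt with rfl | h3
  · simpa [affinePt_ne_inftyPt] using (mem_orderIdeal_inftyPt hinf
      (isHomogeneous_verticalLine α)).2 (by simp)
  · simpa [Ne.symm h2, Ne.symm h3] using mem_orderIdeal_zero F _ x

lemma exists_local_graph_of_Div30 (hp : affinePt α β ∈ D.support) :
    ∃ q : Polynomial ℂ, q.eval α = β ∧
      (Polynomial.X - Polynomial.C α) ^ D (affinePt α β) ∣ restrictGraph q F := by
  have h0 : eval ![α, β, 1] F = 0 := (mem_curve_affinePt hF).1 (hD.1 _ hp)
  rcases Nat.lt_or_ge (D (affinePt α β)) 2 with h | h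
  -- At a simple point the tangent may be vertical, but a constant already has contact 1.
  · refine ⟨Polynomial.C β, by simp, ?_⟩
    have h1 : D (affinePt α β) = 1 := by
      have := Finsupp.mem_support_iff.1 hp
      omega
    rw [h1, pow_one, Polynomial.dvd_iff_isRoot, Polynomial.IsRoot, eval_restrictGraph]
    simpa using h0
  · exact exists_graph_dvd h0 (pderiv_one_ne_zero_of_Div30 hF hns hinf hD h) _

end Div30

lemma exists_graph_of_Div30 {F : Poly3} {d : ℕ} (hF : F.IsHomogeneous d)
    (hns : IsNonsingularCurve F) (hinf : curve F ∩ curve (X 2) = {inftyPt}) {D : Plane →₀ ℕ}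
    (hD : D ∈ Div30 F) :
    ∃ q c : Polynomial ℂ, q.natDegree = 2 ∧ c.Monic ∧ c.natDegree = 3 ∧ c ∣ restrictGraph q F ∧
      graphDivisor q c = D := by
  classical
  have hinf' : inftyPt ∈ curve F := (hinf.symm ▸ Set.mem_singleton _ :
    inftyPt ∈ curve F ∩ curve (X 2)).1
  set x : Plane → ℂ := fun p => p.rep 0 / p.rep 2 with hx
  set y : Plane → ℂ := fun p => p.rep 1 / p.rep 2 with hy
  have hpt : ∀ p ∈ D.support, p = affinePt (x p) (y p) := fun p hp => by
    refine eq_affinePt_of_rep_ne_zero fun h0 => ?_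
    have hp' : p ∈ curve F ∩ curve (X 2) := ⟨hD.1 p hp, by simpa [curve] using h0⟩
    rw [hinf, Set.mem_singleton_iff] at hp'
    exact Finsupp.mem_support_iff.1 hp (hp' ▸ hD.2.2.1)
  have hinj : ∀ p ∈ D.support, ∀ r ∈ D.support, x p = x r → p = r := fun p hp r hr h => by
    have h1 := hpt p hp
    have h2 := hpt r hr
    rw [h1, h] at hp
    rw [h2] at hr
    have := eq_of_mem_support_Div30 hinf' hD hp hr
    rw [h1, h2, h, this]
  have hloc : ∀ p : D.support, ∃ q : Polynomial ℂ, q.eval (x p) = y p ∧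
      (Polynomial.X - Polynomial.C (x p)) ^ D p ∣ restrictGraph q F := fun p => by
    have hp := p.2
    rw [hpt p p.2] at hp
    have := exists_local_graph_of_Div30 hF hns hinf' hD hp
    rwa [← hpt p p.2] at this
  choose ql hql hdl using hloc
  -- Chinese remainder theorem: distinct abscissae make the powers of x - x(p) coprime, so the local
  -- graphs glue.
  obtain ⟨r, hr⟩ := Ideal.exists_forall_sub_mem_ideal
    (I := fun p : D.support => Ideal.span {(Polynomial.X - Polynomial.C (x p)) ^ D p})
    (fun p r hpr => (Ideal.isCoprime_span_singleton_iff _ _).2 (IsCoprime.pow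
      (Polynomial.isCoprime_X_sub_C_of_isUnit_sub (isUnit_iff_ne_zero.2 (sub_ne_zero.2
        fun h => hpr (Subtype.ext (hinj p p.2 r r.2 h))))))) ql
  set c : Polynomial ℂ :=
    ((D.toMultiset.map x).map fun α => Polynomial.X - Polynomial.C α).prod with hc
  have hroots : c.roots = D.toMultiset.map x := Polynomial.roots_multiset_prod_X_sub_C _
  have hmonic : c.Monic := Polynomial.monic_multiset_prod_of_monic _ _
    fun α _ => Polynomial.monic_X_sub_C α
  have hdeg : c.natDegree = 3 := by
    rw [hc, Polynomial.natDegree_multiset_prod_X_sub_C_eq_card, Multiset.card_map,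
      Finsupp.card_toMultiset]
    exact hD.2.1
  have hmult : ∀ p ∈ D.support, c.rootMultiplicity (x p) = D p := fun p hp => by
    rw [← Polynomial.count_roots, hroots, Multiset.count_map_eq_count x _ _ _
      ((Finsupp.mem_toMultiset _ _).2 hp), Finsupp.count_toMultiset]
    intro p hp r hr h
    exact hinj p ((Finsupp.mem_toMultiset _ _).1 hp) r ((Finsupp.mem_toMultiset _ _).1 hr) h
  -- Reduction modulo c keeps the contacts and brings the degree down to at most 2.
  set q := r %ₘ c with hq
  have hqdeg : q.natDegree < 3 := by
    rw [← hdeg]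
    exact Polynomial.natDegree_modByMonic_lt _ hmonic (fun h => by simp [h] at hdeg)
  have hqr : c ∣ q - r := ⟨-(r /ₘ c), by
    have := Polynomial.modByMonic_add_div r c
    linear_combination this⟩
  have hqloc : ∀ p : D.support, (Polynomial.X - Polynomial.C (x p)) ^ D p ∣ q - ql p := fun p => by
    have h1 := Ideal.mem_span_singleton.1 (hr p)
    have h2 := Polynomial.pow_rootMultiplicity_dvd c (x p)
    rw [hmult p p.2] at h2
    simpa using dvd_add (h2.trans hqr) h1
  have hqy : ∀ p ∈ D.support, q.eval (x p) = y p := fun p hp => by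
    have h1 := (dvd_pow_self (Polynomial.X - Polynomial.C (x p))
      (Finsupp.mem_support_iff.1 hp)).trans (hqloc ⟨p, hp⟩)
    rw [Polynomial.dvd_iff_isRoot, Polynomial.IsRoot, Polynomial.eval_sub, sub_eq_zero] at h1
    exact h1.trans (hql ⟨p, hp⟩)
  have hcF : c ∣ restrictGraph q F := by
    rw [dvd_iff_forall_pow_rootMultiplicity_dvd hmonic.ne_zero]
    intro α
    by_cases hα : α ∈ c.roots
    · rw [hroots, Multiset.mem_map] at hα
      obtain ⟨p, hp, rfl⟩ := hα
      rw [Finsupp.mem_toMultiset] at hp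
      rw [hmult p hp]
      have := dvd_add ((hqloc ⟨p, hp⟩).trans (sub_dvd_restrictGraph_sub q (ql ⟨p, hp⟩) F))
        (hdl ⟨p, hp⟩)
      simpa using this
    · rw [← Polynomial.count_roots, Multiset.count_eq_zero_of_notMem hα, pow_zero]
      exact one_dvd _
  have hgD : graphDivisor q c = D := by
    rw [graphDivisor, hroots, Multiset.map_map]
    have : D.toMultiset.map ((fun α => affinePt α (q.eval α)) ∘ x) = D.toMultiset.map id := by
      refine Multiset.map_congr rfl fun p hp => ?_
      rw [Finsupp.mem_toMultiset] at hp
      rw [Function.comp_apply, hqy p hp, ← hpt p hp, id]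
    rw [this, Multiset.map_id, Finsupp.toMultiset_toFinsupp]
  refine ⟨q, c, ?_, hmonic, hdeg, hcF, hgD⟩
  -- If deg q ≤ 1, the graph is a line containing D.
  by_contra hne
  have hle : q.natDegree ≤ 1 := by omega
  have hnc := hD.2.2.2.1
  rw [NotCollinear, Submodule.eq_bot_iff, ← hgD] at hnc
  have hh : (X 1 - C (q.coeff 1) * X 0 - C (q.coeff 0) * X 2 : Poly3).IsHomogeneous 1 :=
    ((isHomogeneous_X _ _).sub (isHomogeneous_C_mul_X _ _)).sub (isHomogeneous_C_mul_X _ _)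
  have hz := hnc _ ((mem_formsThrough_graphDivisor hF hns hmonic.ne_zero hcF).2 ⟨hh, by
    have h0 : restrictGraph q (X 1 - C (q.coeff 1) * X 0 - C (q.coeff 0) * X 2) = 0 := by
      have := Polynomial.eq_X_add_C_of_natDegree_le_one hle
      simp only [map_sub, map_mul, restrictGraph_C, restrictGraph_X0, restrictGraph_X1,
        restrictGraph_X2]
      linear_combination this
    rw [h0]
    exact dvd_zero c⟩)
  simpa using congrArg (eval ![0, 1, 0]) hz

lemma exists_parabola_eq {q c : Polynomial ℂ} (hq : q.natDegree = 2) (hc : c.Monic)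
    (hc3 : c.natDegree = 3) : ∃ (a b : Fin 3 → ℂ) (t : ℂ), a 2 ≠ 0 ∧ t ≠ 0 ∧ parabola a = q ∧
      restrictGraph q (conicB b) = Polynomial.C t * c := by
  set q0 := q.coeff 0
  set q1 := q.coeff 1
  set q2 := q.coeff 2 with hq2
  have h2 : q2 ≠ 0 := by
    rw [hq2, ← hq]
    exact Polynomial.leadingCoeff_ne_zero.2 (by rintro rfl; simp at hq)
  have hqe : q = Polynomial.C q2 * Polynomial.X ^ 2 + Polynomial.C q1 * Polynomial.X
      + Polynomial.C q0 := by
    conv_lhs => rw [Polynomial.as_sum_range_C_mul_X_pow' q (n := 3) (by omega)]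
    simp [Finset.sum_range_succ, q0, q1, q2]
    ring
  have hce : c = Polynomial.X ^ 3 + Polynomial.C (c.coeff 2) * Polynomial.X ^ 2
      + Polynomial.C (c.coeff 1) * Polynomial.X + Polynomial.C (c.coeff 0) := by
    have h3 : c.coeff 3 = 1 := by rw [← hc3]; exact hc
    conv_lhs => rw [Polynomial.as_sum_range_C_mul_X_pow' c (n := 4) (by omega)]
    simp [Finset.sum_range_succ, h3]
    ring
  set b2 := q1 / q2 - c.coeff 2 with hb2
  -- The x³ coefficient of B on the graph is -q2, whence t = -q2; comparing x², x and 1 in turn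
  -- gives b₂, b₁ and b₀.
  refine ⟨![-q0 / q2, -q1 / q2, q2⁻¹],
    ![-q2 * c.coeff 0 - b2 * q0, -q2 * c.coeff 1 + q0 - b2 * q1, b2], -q2, by simpa using h2,
    neg_ne_zero.2 h2, ?_, ?_⟩
  · rw [hqe]
    have e1 : -(-q1 / q2 / q2⁻¹) = q1 := by field_simp
    have e0 : -(-q0 / q2 / q2⁻¹) = q0 := by field_simp
    simp only [parabola, Matrix.cons_val, inv_inv, e1, e0]
  · have hb : Polynomial.C b2 * Polynomial.C q2 = Polynomial.C q1
        - Polynomial.C (c.coeff 2) * Polynomial.C q2 := by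
      rw [← Polynomial.C_mul, ← Polynomial.C_mul, ← Polynomial.C_sub]
      congr 1
      rw [hb2]
      field_simp
    simp only [conicB, Matrix.cons_val, map_sub, map_add, map_mul, map_pow, restrictGraph_C,
      restrictGraph_X0, restrictGraph_X1, restrictGraph_X2, map_neg]
    linear_combination (Polynomial.C b2 - Polynomial.X) * hqe + Polynomial.C q2 * hce
      + Polynomial.X ^ 2 * hb

lemma exists_conicDivisor_eq {F : Poly3} {d : ℕ} (hF : F.IsHomogeneous d)
    (hns : IsNonsingularCurve F) (hinf : curve F ∩ curve (X 2) = {inftyPt}) {D : Plane →₀ ℕ}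
    (hD : D ∈ Div30 F) :
    ∃ a b : Fin 3 → ℂ, a 2 ≠ 0 ∧
      restrictGraph (parabola a) (conicB b) ∣ restrictGraph (parabola a) F ∧
      conicDivisor a b = D := by
  obtain ⟨q, c, hq, hc, hc3, hcF, hcD⟩ := exists_graph_of_Div30 hF hns hinf hD
  obtain ⟨a, b, t, ha, ht, rfl, hb⟩ := exists_parabola_eq hq hc hc3
  refine ⟨a, b, ha, ?_, ?_⟩
  · rw [hb]
    exact (Polynomial.isUnit_C.2 (isUnit_iff_ne_zero.2 ht)).mul_left_dvd.2 hcF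
  · rw [conicDivisor, hb, ← hcD, graphDivisor, graphDivisor, Polynomial.roots_C_mul _ ht]

/-! ### Division by a conic -/

lemma conicA_ne_zero (a : Fin 3 → ℂ) : conicA a ≠ 0 := by
  intro h
  simpa [conicA] using congrArg (eval ![1, 0, 0]) h

/-- With Y = z² q(x/z), vanishing on the parabola gives P(xz, Y, z²) = 0. Since yz - Y = A/a₂,
Taylor expansion shows that A divides P(xz, yz, z²) = zⁿP; the prime z does not divide A and
cancels. -/
lemma conicA_dvd_of_restrictGraph_eq_zero {a : Fin 3 → ℂ} (ha : a 2 ≠ 0) {P : Poly3} {n : ℕ}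
    (hP : P.IsHomogeneous n) (h : restrictGraph (parabola a) P = 0) : conicA a ∣ P := by
  set Y : Poly3 := C (a 2)⁻¹ * (X 0 ^ 2 - C (a 1) * (X 0 * X 2) - C (a 0) * X 2 ^ 2) with hY
  have hz : aeval ![X 0 * X 2, Y, X 2 * X 2] P = (0 : Poly3) := by
    have hX : (X 2 : Poly3) ≠ 0 := X_ne_zero 2
    -- The extra factor z restricts the pointwise check to z ≠ 0.
    refine (mul_eq_zero.1 ?_).resolve_left hX
    refine MvPolynomial.funext fun v => ?_
    rw [map_zero, eval_mul, eval_X]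
    rcases eq_or_ne (v 2) 0 with h0 | h0
    · rw [h0, zero_mul]
    have e1 := aeval_vec_three ((aeval v).comp (aeval ![X 0 * X 2, Y, X 2 * X 2])) P
    simp only [AlgHom.comp_apply, aeval_eq_eval] at e1
    have e2 : (![eval v ((aeval ![X 0 * X 2, Y, X 2 * X 2]) (X 0 : Poly3)),
        eval v ((aeval ![X 0 * X 2, Y, X 2 * X 2]) (X 1 : Poly3)),
        eval v ((aeval ![X 0 * X 2, Y, X 2 * X 2]) (X 2 : Poly3))] : Fin 3 → ℂ) =
        (v 2 ^ 2) • ![v 0 / v 2, (parabola a).eval (v 0 / v 2), 1] := by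
      ext i
      fin_cases i
      · simp; field_simp
      · simp [hY, parabola]; field_simp; ring
      · simp; ring
    rw [e1, e2, eval_smul_of_isHomogeneous hP, ← eval_restrictGraph, h]
    simp
  obtain ⟨k, hk⟩ := exists_taylor_second P (X 0 * X 2) Y (X 2 * X 2 : Poly3) (X 1 * X 2 - Y)
  have hA : X 1 * X 2 - Y = C (a 2)⁻¹ * conicA a := by
    have : C (a 2)⁻¹ * C (a 2) = (1 : Poly3) := by
      rw [← C_mul, inv_mul_cancel₀ ha, C_1]
    rw [hY, conicA]
    linear_combination (-X 1 * X 2) * this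
  have hl : aeval ![X 0 * X 2, X 1 * X 2, X 2 * X 2] P = X 2 ^ n * P := by
    have h1 := aeval_mul_of_isHomogeneous hP (X 2 : Poly3) X
    rw [aeval_X_left_apply] at h1
    rw [← h1]
    congr 2
    ext1 i
    fin_cases i <;> simp [mul_comm]
  rw [add_sub_cancel, hz, hA, hl] at hk
  have hdvd : conicA a ∣ X 2 ^ n * P := ⟨C (a 2)⁻¹ * (aeval ![X 0 * X 2, Y, X 2 * X 2] (pderiv 1 P)
    + k * C (a 2)⁻¹ * conicA a), by rw [hk]; ring⟩
  obtain ⟨G, hG⟩ := hdvd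
  have hn : ¬ (X 2 : Poly3) ∣ conicA a := by
    rintro ⟨R, hR⟩
    simpa [conicA] using congrArg (eval ![1, 0, 0]) hR
  obtain ⟨R, hR⟩ := (X_prime (R := ℂ) (i := (2 : Fin 3))).pow_dvd_of_dvd_mul_left n hn ⟨P, hG.symm⟩
  refine ⟨R, mul_left_cancel₀ (pow_ne_zero n (X_ne_zero (R := ℂ) (2 : Fin 3))) ?_⟩
  rw [hG, hR]
  ring

lemma exists_isHomogeneous_of_dvd {A P : Poly3} {m n : ℕ} (hA : A.IsHomogeneous m)
    (hP : P.IsHomogeneous (m + n)) (h : A ∣ P) : ∃ G : Poly3, G.IsHomogeneous n ∧ P = A * G := by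
  obtain ⟨G, rfl⟩ := h
  refine ⟨homogeneousComponent n G, homogeneousComponent_isHomogeneous n G, ?_⟩
  have h1 := homogeneousComponent_eq_self hP
  conv_lhs at h1 => rw [← sum_homogeneousComponent G]
  rw [Finset.mul_sum, map_sum] at h1
  have h2 : ∀ i, homogeneousComponent (m + n) (A * homogeneousComponent i G) =
      if i = n then A * homogeneousComponent n G else 0 := fun i => by
    rw [homogeneousComponent_of_mem (hA.mul (homogeneousComponent_isHomogeneous i G))]
    by_cases hi : i = n
    · simp [hi]
    · rw [if_neg (by omega), if_neg hi]
  simp_rw [h2] at h1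
  rw [Finset.sum_ite_eq'] at h1
  rw [← h1]
  split_ifs with hmem
  · rfl
  · rw [homogeneousComponent_eq_zero n G (by simpa using hmem), mul_zero]

/-! ### Behaviour of the quartic at infinity -/

lemma mem_curve_mk {F : Poly3} {d : ℕ} (hF : F.IsHomogeneous d) {v : Fin 3 → ℂ} (hv : v ≠ 0) :
    Projectivization.mk ℂ v hv ∈ curve F ↔ eval v F = 0 := by
  obtain ⟨t, ht⟩ := Projectivization.exists_smul_eq_mk_rep ℂ v hv
  have : (t : ℂ) ≠ 0 := t.ne_zero
  rw [curve, Set.mem_ofPred_eq, ← ht]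
  change eval ((t : ℂ) • v) F = 0 ↔ _
  rw [eval_smul_of_isHomogeneous hF]
  simp [this]

section Infinity

variable {F : Poly3} (hF : F.IsHomogeneous 4) (hns : IsNonsingularCurve F)
  (hinf : curve F ∩ curve (X 2) = {inftyPt})

include hinf in
lemma inftyPt_mem_curve : inftyPt ∈ curve F :=
  (hinf.symm ▸ Set.mem_singleton _ : inftyPt ∈ curve F ∩ curve (X 2)).1

include hF hinf

/-- As ∞ lies on X, F(1, y, 0) has degree at most 3; a nonzero y³ coefficient would give it a root,
that is, a second point on z = 0. -/
lemma exists_coeff_of_hyperflex : ∃ c : ℕ → ℕ → ℂ, c 0 4 = 0 ∧ c 1 3 = 0 ∧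
    F = ∑ i ∈ Finset.range 5, ∑ j ∈ Finset.range (5 - i),
      C (c i j) * (X 0 ^ i * X 1 ^ j * X 2 ^ (4 - i - j)) := by
  obtain ⟨c, hc⟩ := exists_eq_sum_of_isHomogeneous hF
  have h04 : c 0 4 = 0 := by
    have := (mem_curve_inftyPt hF).1 (inftyPt_mem_curve hinf)
    rw [hc] at this
    simpa [Finset.sum_range_succ] using this
  refine ⟨c, h04, ?_, hc⟩
  set p : Polynomial ℂ := Polynomial.C (c 1 3) * Polynomial.X ^ 3
    + Polynomial.C (c 2 2) * Polynomial.X ^ 2 + Polynomial.C (c 3 1) * Polynomial.X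
    + Polynomial.C (c 4 0) with hp
  by_contra h13
  have hdeg : p.natDegree = 3 := Polynomial.natDegree_cubic h13
  obtain ⟨y, hy⟩ := IsAlgClosed.exists_root p (fun h => by
    rw [Polynomial.natDegree_eq_of_degree_eq_some h] at hdeg
    simp at hdeg)
  have hv : ![1, y, 0] ≠ (0 : Fin 3 → ℂ) := fun h => one_ne_zero (α := ℂ) (congrFun h 0)
  have hm : Projectivization.mk ℂ ![1, y, 0] hv ∈ curve F ∩ curve (X 2) := by
    refine ⟨(mem_curve_mk hF hv).2 ?_, (mem_curve_mk (isHomogeneous_X _ 2) hv).2 (by simp)⟩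
    rw [hc]
    simp [hp] at hy
    simp [Finset.sum_range_succ, h04]
    linear_combination hy
  rw [hinf, Set.mem_singleton_iff, inftyPt, Projectivization.mk_eq_mk_iff'] at hm
  obtain ⟨t, ht⟩ := hm
  simpa using congrFun ht 0

lemma pderiv_zero_inftyPt : eval ![0, 1, 0] (pderiv 0 F) = 0 := by
  obtain ⟨c, h04, h13, hc⟩ := exists_coeff_of_hyperflex hF hinf
  rw [hc]
  simp [Finset.sum_range_succ, h04, h13, pderiv_X]

include hns in
lemma pderiv_two_inftyPt : eval ![0, 1, 0] (pderiv 2 F) ≠ 0 := by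
  have h0 := pderiv_zero_inftyPt hF hinf
  have hF0 := (mem_curve_inftyPt hF).1 (inftyPt_mem_curve hinf)
  have h1 := congrArg (eval ![0, 1, 0]) (euler_identity hF)
  simp [h0, hF0] at h1
  obtain ⟨i, hi⟩ := hns ![0, 1, 0] (fun h => one_ne_zero (α := ℂ) (congrFun h 1)) hF0
  fin_cases i
  · exact absurd h0 hi
  · exact absurd h1 hi
  · exact hi

/-- The monomial x^i y^j contributes degree at most i + 2j, which exceeds 6 only for the absent y⁴
and xy³. -/
lemma natDegree_restrictGraph_le {q : Polynomial ℂ} (hq : q.natDegree = 2) :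
    (restrictGraph q F).natDegree ≤ 6 := by
  obtain ⟨c, h04, h13, hc⟩ := exists_coeff_of_hyperflex hF hinf
  rw [hc, map_sum]
  refine Polynomial.natDegree_sum_le_of_forall_le _ _ fun i hi => ?_
  rw [map_sum]
  refine Polynomial.natDegree_sum_le_of_forall_le _ _ fun j hj => ?_
  simp only [map_mul, map_pow, restrictGraph_C, restrictGraph_X0, restrictGraph_X1,
    restrictGraph_X2, one_pow, mul_one]
  rw [Finset.mem_range] at hi hj
  by_cases h : i + 2 * j ≤ 6
  · refine (Polynomial.natDegree_C_mul_le _ _).trans (Polynomial.natDegree_mul_le.trans ?_)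
    have := Polynomial.natDegree_pow_le (p := q) (n := j)
    rw [hq] at this
    rw [Polynomial.natDegree_X_pow]
    omega
  · have : (i = 0 ∧ j = 4) ∨ (i = 1 ∧ j = 3) := by omega
    rcases this with ⟨rfl, rfl⟩ | ⟨rfl, rfl⟩
    · simp [h04]
    · simp [h13]

end Infinity

/-! ### Quadruples -/

lemma coeff_xy_conicB (b : Fin 3 → ℂ) :
    coeff (Finsupp.single 0 1 + Finsupp.single 1 1) (conicB b) = -1 := by
  have h : (X 0 * X 1 : Poly3) = monomial (Finsupp.single 0 1 + Finsupp.single 1 1) 1 := by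
    rw [X, X, monomial_mul, one_mul]
  rw [conicB, h, sq]
  simp [coeff_mul_X', ← mul_assoc]

lemma isHomogeneous_conic (e : Fin 6 → ℂ) : (conic e).IsHomogeneous 2 := by
  have h (i j : Fin 3) : (X i * X j : Poly3).IsHomogeneous 2 :=
    (isHomogeneous_X _ i).mul (isHomogeneous_X _ j)
  rw [conic, sq, sq, sq]
  exact ((((((h 2 2).C_mul _).add ((h 0 2).C_mul _)).add ((h 1 2).C_mul _)).add
    ((h 0 0).C_mul _)).add ((h 0 1).C_mul _)).add ((h 1 1).C_mul _)

/-- The cubic term comes from xy: on the parabola x³ = a₂xy + a₁x² + a₀x. -/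
lemma exists_conic_restrictGraph {a : Fin 3 → ℂ} (ha : a 2 ≠ 0) {g : Polynomial ℂ}
    (hg : g.natDegree ≤ 3) :
    ∃ H : Poly3, H.IsHomogeneous 2 ∧ restrictGraph (parabola a) H = g := by
  refine ⟨conic ![g.coeff 0, g.coeff 1 + g.coeff 3 * a 0, 0, g.coeff 2 + g.coeff 3 * a 1,
    g.coeff 3 * a 2, 0], isHomogeneous_conic _, ?_⟩
  have hA := C_mul_parabola ha
  have hge : g = Polynomial.C (g.coeff 3) * Polynomial.X ^ 3
      + Polynomial.C (g.coeff 2) * Polynomial.X ^ 2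
      + Polynomial.C (g.coeff 1) * Polynomial.X + Polynomial.C (g.coeff 0) := by
    conv_lhs => rw [Polynomial.as_sum_range_C_mul_X_pow' g (n := 4) (by omega)]
    simp [Finset.sum_range_succ]
    ring
  conv_rhs => rw [hge]
  simp [conic]
  linear_combination Polynomial.C (g.coeff 3) * Polynomial.X * hA

section Quadruple

variable {F : Poly3} (hF : F.IsHomogeneous 4) {a b : Fin 3 → ℂ} (ha : a 2 ≠ 0)
include ha

lemma restrictGraph_eq_of_eq_add {G H : Poly3} (h : F = conicA a * G + conicB b * H) :
    restrictGraph (parabola a) F =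
      restrictGraph (parabola a) (conicB b) * restrictGraph (parabola a) H := by
  rw [h, map_add, map_mul, map_mul, restrictGraph_conicA ha, zero_mul, zero_add]

include hF in
lemma exists_cofactors (hinf : curve F ∩ curve (X 2) = {inftyPt})
    (h : restrictGraph (parabola a) (conicB b) ∣ restrictGraph (parabola a) F) :
    ∃ G H : Poly3, G.IsHomogeneous 2 ∧ H.IsHomogeneous 2 ∧ F = conicA a * G + conicB b * H ∧
      coeff (Finsupp.single 0 1 + Finsupp.single 1 1) G = 1 := by
  obtain ⟨g, hg⟩ := h
  have hc := natDegree_restrictGraph_conicB (b := b) ha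
  have hg3 : g.natDegree ≤ 3 := by
    rcases eq_or_ne g 0 with rfl | hg0
    · simp
    · have h6 := natDegree_restrictGraph_le hF hinf (natDegree_parabola ha)
      rw [hg, Polynomial.natDegree_mul (restrictGraph_conicB_ne_zero ha) hg0, hc] at h6
      omega
  obtain ⟨H, hH, hHg⟩ := exists_conic_restrictGraph ha hg3
  have hP : (F - conicB b * H).IsHomogeneous (2 + 2) := hF.sub ((isHomogeneous_conicB b).mul hH)
  obtain ⟨G, hG, hGe⟩ := exists_isHomogeneous_of_dvd (isHomogeneous_conicA a) hP
    (conicA_dvd_of_restrictGraph_eq_zero ha hP (by rw [map_sub, map_mul, hHg, hg, sub_self]))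
  -- The xy coefficient of B is -1, so adding tB to G lowers g₁₁ by t.
  set t := coeff (Finsupp.single 0 1 + Finsupp.single 1 1) G - 1 with ht
  refine ⟨G + C t * conicB b, H - C t * conicA a, hG.add ((isHomogeneous_conicB b).C_mul t),
    hH.sub ((isHomogeneous_conicA a).C_mul t), ?_, ?_⟩
  · linear_combination hGe
  · rw [coeff_add, coeff_C_mul, coeff_xy_conicB, ht]
    ring

/-- H - H' vanishes on the parabola, so it is rA with r constant by degree; then G' - G = rB, and
its xy coefficient gives r = 0. -/
lemma cofactors_unique {G H G' H' : Poly3} (hH : H.IsHomogeneous 2) (hH' : H'.IsHomogeneous 2)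
    (h : F = conicA a * G + conicB b * H) (h' : F = conicA a * G' + conicB b * H')
    (hG : coeff (Finsupp.single 0 1 + Finsupp.single 1 1) G = 1)
    (hG' : coeff (Finsupp.single 0 1 + Finsupp.single 1 1) G' = 1) : G = G' ∧ H = H' := by
  have e := (restrictGraph_eq_of_eq_add ha h).symm.trans (restrictGraph_eq_of_eq_add ha h')
  have e2 := mul_left_cancel₀ (restrictGraph_conicB_ne_zero ha) e
  have hHH : (H - H').IsHomogeneous (2 + 0) := hH.sub hH'
  obtain ⟨s, hs, hse⟩ := exists_isHomogeneous_of_dvd (isHomogeneous_conicA a) hHH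
    (conicA_dvd_of_restrictGraph_eq_zero ha hHH (by rw [map_sub, e2, sub_self]))
  obtain ⟨r, rfl⟩ : ∃ r, s = C r :=
    ⟨_, totalDegree_eq_zero_iff_eq_C.1 ((totalDegree_zero_iff_isHomogeneous _).2 hs)⟩
  have hGG : G' - G = C r * conicB b := by
    refine mul_left_cancel₀ (conicA_ne_zero a) ?_
    linear_combination h - h' + conicB b * hse
  have hr : r = 0 := by
    have := congrArg (coeff (Finsupp.single 0 1 + Finsupp.single 1 1)) hGG
    rw [coeff_sub, hG, hG', coeff_C_mul, coeff_xy_conicB] at this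
    linear_combination this
  subst hr
  rw [C_0, mul_zero, sub_eq_zero] at hse
  rw [C_0, zero_mul, sub_eq_zero] at hGG
  exact ⟨hGG.symm, hse⟩

end Quadruple

/-- The tangent at ∞ is z = 0, so F_x(∞) = -H(∞) is zero. Then F_z(∞) = a₀₁G(∞), which must not
vanish. -/
lemma conicA_coeff_ne_zero {F G H : Poly3} (hF : F.IsHomogeneous 4) (hns : IsNonsingularCurve F)
    (hinf : curve F ∩ curve (X 2) = {inftyPt}) {a b : Fin 3 → ℂ}
    (h : F = conicA a * G + conicB b * H) : a 2 ≠ 0 := by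
  intro ha
  have h0 := pderiv_zero_inftyPt hF hinf
  have h2 := pderiv_two_inftyPt hF hns hinf
  rw [h] at h0 h2
  have hH : eval ![0, 1, 0] H = 0 := by
    simpa [conicA, conicB, pderiv_X] using h0
  apply h2
  simp [conicA, conicB, pderiv_X, ha, hH]

/-! ### The bijection -/

theorem theorem3p1 (F : Poly3) (hF : F.IsHomogeneous 4) (hns : IsNonsingularCurve F)
    (hinf : curve F ∩ curve (X 2) = {inftyPt}) :
    ∃ φ : Div30 F ≃ ZSet F, ∀ D : Div30 F,
      Submodule.span ℂ {(φ D).1.A, (φ D).1.B} =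
        formsThrough F 2 (D.1 + Finsupp.single inftyPt 1) := by
  have hinf' := inftyPt_mem_curve hinf
  -- The common parameter space: `f` maps it bijectively to divisors and `g` to quadruples.
  let T := {ab : (Fin 3 → ℂ) × (Fin 3 → ℂ) // ab.1 2 ≠ 0 ∧
    restrictGraph (parabola ab.1) (conicB ab.2) ∣ restrictGraph (parabola ab.1) F}
  let f : T → Div30 F := fun ab => ⟨conicDivisor ab.1.1 ab.1.2,
    conicDivisor_mem_Div30 hF hns hinf' ab.2.1 ab.2.2⟩
  have hspan (ab : T) : Submodule.span ℂ {conicA ab.1.1, conicB ab.1.2} =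
      formsThrough F 2 ((f ab).1 + Finsupp.single inftyPt 1) :=
    span_conics_eq_formsThrough hF hns hinf' ab.2.1 ab.2.2
  have hf : Function.Bijective f := by
    refine ⟨fun ab ab' he => ?_, fun D => ?_⟩
    · have hs := (hspan ab).trans (he ▸ (hspan ab').symm)
      obtain ⟨s, t, hA⟩ := Submodule.mem_span_pair.1
        (hs ▸ Submodule.subset_span (Set.mem_insert _ _) :
          conicA ab'.1.1 ∈ Submodule.span ℂ {conicA ab.1.1, conicB ab.1.2})
      obtain ⟨s', t', hB⟩ := Submodule.mem_span_pair.1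
        (hs ▸ Submodule.subset_span (Set.mem_insert_of_mem _ rfl) :
          conicB ab'.1.2 ∈ Submodule.span ℂ {conicA ab.1.1, conicB ab.1.2})
      exact Subtype.ext (Prod.ext (conicA_combination hA).symm (conicB_combination hB).symm)
    · obtain ⟨a, b, ha, hd, he⟩ := exists_conicDivisor_eq hF hns hinf D.2
      exact ⟨⟨(a, b), ha, hd⟩, Subtype.ext he⟩
  choose G H hG hH hFe hco using fun ab : T => exists_cofactors hF ab.2.1 hinf ab.2.2
  let g : T → ZSet F := fun ab => ⟨⟨conicA ab.1.1, conicB ab.1.2, G ab, H ab⟩,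
    isHomogeneous_conicA _, isHomogeneous_conicB _, hG ab, hH ab, hFe ab,
    ⟨_, _, _, rfl⟩, ⟨_, _, _, rfl⟩, hco ab⟩
  have hg : Function.Bijective g := by
    refine ⟨fun ab ab' he => ?_, ?_⟩
    · have hA : conicA ab.1.1 = conicA ab'.1.1 := congrArg (fun Q => Q.1.A) he
      have hB : conicB ab.1.2 = conicB ab'.1.2 := congrArg (fun Q => Q.1.B) he
      refine Subtype.ext (Prod.ext ?_ ?_)
      · exact conicA_combination (s := 1) (t := 0) (b := 0) (by simp [hA])
      · exact conicB_combination (s := 0) (t := 1) (a := 0) (by simp [hB])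
    · rintro ⟨⟨A, B, G', H'⟩, -, -, hG', hH', hFe', ⟨a0, a1, a2, hA⟩, ⟨b0, b1, b2, hB⟩, hco'⟩
      obtain rfl : A = conicA ![a0, a1, a2] := hA
      obtain rfl : B = conicB ![b0, b1, b2] := hB
      have ha := conicA_coeff_ne_zero hF hns hinf hFe'
      let ab : T := ⟨(![a0, a1, a2], ![b0, b1, b2]), ha, _, restrictGraph_eq_of_eq_add ha hFe'⟩
      obtain ⟨h1, h2⟩ := cofactors_unique ha (hH ab) hH' (hFe ab) hFe' (hco ab) hco'
      exact ⟨ab, Subtype.ext (Quadruple.ext rfl rfl h1 h2)⟩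
  refine ⟨(Equiv.ofBijective f hf).symm.trans (Equiv.ofBijective g hg), fun D => ?_⟩
  obtain ⟨ab, rfl⟩ := hf.2 D
  rw [Equiv.trans_apply, Equiv.ofBijective_symm_apply_apply f hf]
  exact hspan ab
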